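/- **Setting.** Let $\mathfrak M$ be a signed cancellation meadow: a commutative ring with $1$, a total unary operation ${}^{-1}$ and a unary operation $\mathsf s$ such that $(x^{-1})^{-1}=x$; $x\cdot(x\cdot x^{-1})=x$; $x\neq 0\wedge xy=xz\Rightarrow y=z$; $\mathsf s(x/x)=x/x$; $\mathsf s(1-x/x)=1-x/x$; $\mathsf s(-1)=-1$; $\mathsf s(x^{-1})=\mathsf s(x)$; $\mathsf s(xy)=\mathsf s(x)\mathsf s(y)$; $\bigl(1-\frac{\mathsf s(x)-\mathsf s(y)}{\mathsf s(x)-\mathsf s(y)}\bigr)(\mathsf s(x+y)-\mathsf s(x))=0$, where $x/y=x\cdot y^{-1}$. Let $P=\{\pi\in\mathfrak M:\mathsf s(\mathsf s(\pi)+1)\cdot\mathsf s(\mathsf s(1-\pi)+1)=1\}$ be the set of probabilities. Let $A$ be a set of actions, $\delta\notin A$, $A_\delta=A\cup\{\delta\}$, and let $\gamma:A_\delta\times A_\delta\to A_\delta$ be commutative and associative with $\gamma(\delta,a)=\delta$ for all $a\in A_\delta$. **pACP.** Terms are built from countably many variables, the constants $a\in A_\delta$, the binary operators $+$, $\cdot$,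 $+_\pi$ ($\pi\in P$), $\parallel$, $\llfloor$ (left merge), $\mid$, and the unary operators $\partial_H$ ($H\subseteq A$). The axioms, with $a,b\in A_\delta$, $H\subseteq A$, $\pi,\rho\in P$, are: $x+y=y+x$; $(x+y)+z=x+(y+z)$; $a+a=a$; $(x+y)z=xz+yz$; $(xy)z=x(yz)$; $x+\delta=x$; $\delta x=\delta$; $\partial_H(a)=a$ if $a\notin H$; $\partial_H(a)=\delta$ if $a\in H$; $\partial_H(x+y)=\partial_H(x)+\partial_H(y)$; $\partial_H(xy)=\partial_H(x)\partial_H(y)$; $\partial_H(x+_\pi y)=\partial_H(x)+_\pi\partial_H(y)$; $x+_\pi y=y+_{1-\pi}x$; $(x+_\pi y)+_\rho z=x+_{\pi\rho}(y+_{\frac{(1-\pi)\rho}{1-\pi\rho}}z)$; $x+_\pi x=x$; $(x+_\pi y)z=xz+_\pi yz$; $(x+_\pi y)+z=(x+z)+_\pi(y+z)$; $x+_1y=x$; $x=x+x\wedge y=y+y\Rightarrow x\parallel y=x\llfloor y+y\llfloor x+x\mid y$; $a\llfloor x=ax$; $ax\llfloor y=a(x\parallel y)$; $(x+y)\llfloor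 z=x\llfloor z+y\llfloor z$; $ax\mid b=\gamma(a,b)x$; $a\mid bx=\gamma(a,b)x$; $ax\mid by=\gamma(a,b)(x\parallel y)$; $(x+y)\mid z=x\mid z+y\mid z$; $x\mid(y+z)=x\mid y+x\mid z$; $\delta\mid x=\delta$; $x\mid\delta=\delta$; $a\mid b=\gamma(a,b)$; $(x+_\pi y)\,\square\,z=(x\,\square\,z)+_\pi(y\,\square\,z)$ and $x\,\square\,(y+_\pi z)=(x\,\square\,y)+_\pi(x\,\square\,z)$ for each $\square\in\{\parallel,\llfloor,\mid\}$. **Strategic interleaving.** For $n\geq 1$ the sets $\mathcal H_n$ of interleaving histories for $n$ processes are the sets of finite sequences of pairs of positive integers inductively defined by: the empty sequence is in $\mathcal H_n$; $(i,n)\in\mathcal H_n$ if $i\le n+1$; if $h\frown(i,n)\in\mathcal H_n$, $j\le n$ and $n-1\le m\le n+1$, then $h\frown(i,n)\frown(j,m)\in\mathcal H_m$. Fix a set $S$; for each $n\ge1$ a partial function $\sigma_n:\mathcal H_n\times S\rightharpoonup(\{1,\dots,n\}\to P)$ with $\sum_{i=1}^n\sigma_n(h,s)(i)=1$ whenever $\sigma_n(h,s)$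 is defined, and a function $\vartheta_n:\mathcal H_n\times S\times\{1,\dots,n\}\times A\times\{0,1\}\to S$; and a set $C\subseteq A$ with, for each $c\in C$, an action $\overline c\in A\setminus C$; such that $\vartheta_n(h,s,i,a,0)=s$ for $a\in A\setminus C$, and $\gamma(a,b)\ne c$, $\gamma(a,b)\neq\overline c$, $\gamma(a,c)=\gamma(a,\overline c)=\delta$ for all $a,b\in A$, $c\in C$. The signature of pACP+pSI extends that of pACP by $n$-ary operators $\|^n_{h,s}$ (strategic interleaving) and $\lfloor^{n,i}_{h,s}$ (positional strategic interleaving) for $n\ge1$, $1\le i\le n$, $h\in\mathcal H_n$, $s\in S$. Fix also a set $D$ and for each $d\in D$ actions $\mathsf{cr}(d),\overline{\mathsf{cr}}(d)\in A$ and a closed pACP+pSI term $\phi(d)$, such that $\gamma(\mathsf{cr}(d),a)=\delta$ and $\gamma(a,b)\ne\mathsf{cr}(d)$ for all $a,b\in A$. The axioms of pACP+pSI are those of pACP and the following, where $x[t]_i$ is the tuple $x=(x_1,\dots,x_n)$ with $i$th entry replaced by $t$, $x\setminus i$ is $x$ without its $i$th entry, and $a$ ranges over the actions that are not of the form $\mathsf{cr}(d)$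 or $\overline{\mathsf{cr}}(d)$: - $x_1=x_1+x_1\wedge\dots\wedge x_n=x_n+x_n\Rightarrow\|^n_{h,s}(x)=\delta$ if $\sigma_n(h,s)$ is undefined; - $x_1=x_1+x_1\wedge\dots\wedge x_n=x_n+x_n\Rightarrow\|^n_{h,s}(x)=\bigoplus_{i=1}^n[\sigma_n(h,s)(i)]\,\lfloor^{n,i}_{h,s}(x)$ if $\sigma_n(h,s)$ is defined, where $\bigoplus_{i=1}^1[\pi_i]t_i=t_1$ and $\bigoplus_{i=1}^{n+1}[\pi_i]t_i=t_1+_{\pi_1}\bigoplus_{i=1}^n[\tfrac{\pi_{i+1}}{1-\pi_1}]t_{i+1}$; - $\lfloor^{n,i}_{h,s}(x[\delta]_i)=\delta$; $\lfloor^{1,1}_{h,s}(a)=a$; - $\lfloor^{n+1,i}_{h,s}(x[a]_i)=a\cdot\|^n_{h\frown(i,n),\,\vartheta_{n+1}(h,s,i,a,1)}(x\setminus i)$; - $\lfloor^{n,i}_{h,s}(x[a\cdot y]_i)=a\cdot\|^n_{h\frown(i,n),\,\vartheta_n(h,s,i,a,0)}(x[y]_i)$; - $\lfloor^{n,i}_{h,s}(x[\mathsf{cr}(d)]_i)=\overline{\mathsf{cr}}(d)\cdot\|^n_{h\frown(i,n),\,\vartheta_n(h,s,i,\mathsf{cr}(d),1)}(x\setminus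 i,\phi(d))$; - $\lfloor^{n,i}_{h,s}(x[\mathsf{cr}(d)\cdot y]_i)=\overline{\mathsf{cr}}(d)\cdot\|^{n+1}_{h\frown(i,n+1),\,\vartheta_n(h,s,i,\mathsf{cr}(d),0)}(x[y]_i,\phi(d))$; - $\lfloor^{n,i}_{h,s}(x[y+z]_i)=\lfloor^{n,i}_{h,s}(x[y]_i)+\lfloor^{n,i}_{h,s}(x[z]_i)$; $\;f(x[y+_\pi z]_i)=f(x[y]_i)+_\pi f(x[z]_i)$ for $f=\|^n_{h,s}$ and for $f=\lfloor^{n,i}_{h,s}$; - $\lfloor^{n,i}_{h,s}(x[e]_i)=\delta$ and $\lfloor^{n,i}_{h,s}(x[e\cdot y]_i)=\delta$ for each action $e$ that is of the form $\overline{\mathsf{cr}}(d)$ and not of the form $\mathsf{cr}(d')$. **Guarded recursion.** Let $T$ be pACP or pACP+pSI. A $T$ term is guarded if each occurrence of a variable in it lies within $t'$ for some subterm $a\cdot t'$ with $a\in A$. A recursive specification over $T$ is a set $E=\{X=t_X : X\in V\}$, $V$ a set of variables, with each $t_X$ a $T$ term containing only variables from $V$; it is guarded if each $t_X$ can be rewritten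 to a guarded $T$ term using the axioms of $T$ in either direction and the equations $Y=t_Y$ ($Y\in V$, $Y\ne X$) from left to right. $T_{\mathrm{rec}}$ is $T$ with, for each guarded recursive specification $E$ over $T$ and each variable $X$ of $E$, an additional constant $\langle X|E\rangle$, and with the axioms (RDP) $\langle X|E\rangle=\langle t_X|E\rangle$, where $\langle t|E\rangle$ is $t$ with each variable $Y$ of $E$ replaced by $\langle Y|E\rangle$, and (RSP) $\bigwedge_{Y\in V}Y=t_Y\Rightarrow X=\langle X|E\rangle$. Derivability is derivability in infinitary conditional equational logic. **Corollary.** For each closed pACP+pSI$_{\mathrm{rec}}$ term $t$ there exists a closed pACP$_{\mathrm{rec}}$ term $t'$ (for the same $A$, $\gamma$ and $\mathfrak M$) such that $t=t'$ is derivable from the axioms of pACP+pSI$_{\mathrm{rec}}$. -/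

import Mathlib

namespace PSI

universe u v w z k o

/-! ### Signed cancellation meadows -/

/-- A signed cancellation meadow: a commutative ring with a total inverse and a signum operation.
The separation axiom `0 ≠ 1` is not required. `x * x⁻¹` is what is usually written `x / x`. -/
class SignedCancellationMeadow (M : Type u) extends CommRing M, Inv M where
  sgn : M → M
  meadow_inv_inv : ∀ x : M, (x⁻¹)⁻¹ = x
  meadow_mul_mul_inv : ∀ x : M, x * (x * x⁻¹) = x
  cancellation : ∀ x y z : M, x ≠ 0 → x * y = x * z → y = z
  sgn_div_self : ∀ x : M, sgn (x * x⁻¹) = x * x⁻¹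
  sgn_one_sub_div_self : ∀ x : M, sgn (1 - x * x⁻¹) = 1 - x * x⁻¹
  sgn_neg_one : sgn (-1) = -1
  sgn_inv : ∀ x : M, sgn x⁻¹ = sgn x
  sgn_mul : ∀ x y : M, sgn (x * y) = sgn x * sgn y
  sgn_add : ∀ x y : M,
    (1 - (sgn x - sgn y) * (sgn x - sgn y)⁻¹) * (sgn (x + y) - sgn x) = 0

open SignedCancellationMeadow in
/-- The probabilities: the elements between `0` and `1` for the order defined by `sgn`. -/
def IsProb {M : Type u} [SignedCancellationMeadow M] (p : M) : Prop :=
  sgn (sgn p + 1) * sgn (sgn (1 - p) + 1) = 1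

abbrev Prob (M : Type u) [SignedCancellationMeadow M] : Type u := {p : M // IsProb p}

section Meadow

open SignedCancellationMeadow

variable {M : Type u} [SignedCancellationMeadow M]

theorem sgn_zero : sgn (0 : M) = 0 := by
  have h := sgn_div_self (0 : M)
  simpa using h

theorem sgn_one : sgn (1 : M) = 1 := by
  have h := sgn_one_sub_div_self (0 : M)
  simpa using h

theorem mul_inv_self {x : M} (hx : x ≠ 0) : x * x⁻¹ = 1 :=
  cancellation x _ _ hx (by rw [meadow_mul_mul_inv, mul_one])

theorem inv_zero' : (0 : M)⁻¹ = 0 := by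
  have h := meadow_mul_mul_inv ((0 : M)⁻¹)
  rw [meadow_inv_inv] at h
  simpa using h.symm

theorem mul_eq_zero_imp {x y : M} (h : x * y = 0) : x = 0 ∨ y = 0 := by
  by_cases hx : x = 0
  · exact Or.inl hx
  · exact Or.inr (cancellation x y 0 hx (by rw [h, mul_zero]))

theorem sgn_cases {x : M} (hx : x ≠ 0) : sgn x = 1 ∨ sgn x = -1 := by
  have h : sgn x * sgn x = 1 := by
    have h1 : sgn (x * x⁻¹) = 1 := by rw [mul_inv_self hx, sgn_one]
    rwa [sgn_mul, sgn_inv] at h1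
  have h2 : (sgn x - 1) * (sgn x + 1) = 0 := by linear_combination h
  rcases mul_eq_zero_imp h2 with h3 | h3
  · left; linear_combination h3
  · right; linear_combination h3

/-- Auxiliary form of nonnegativity, `x = 0` or `sgn x = 1`. -/
def NN (x : M) : Prop := x = 0 ∨ sgn x = 1

theorem NN.mul {x y : M} (hx : NN x) (hy : NN y) : NN (x * y) := by
  rcases hx with rfl | hx
  · left; simp
  rcases hy with rfl | hy
  · left; simp
  right; rw [sgn_mul, hx, hy, mul_one]

theorem NN.inv {x : M} (hx : NN x) : NN x⁻¹ := by
  rcases hx with rfl | hx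
  · left; exact inv_zero'
  right; rw [sgn_inv, hx]

theorem NN.add {x y : M} (hx : NN x) (hy : NN y) : NN (x + y) := by
  rcases hx with rfl | hx
  · simpa using hy
  rcases hy with rfl | hy
  · right; simpa using hx
  right
  have h := sgn_add x y
  rw [hx, hy] at h
  simp only [sub_self, zero_mul, sub_zero, one_mul] at h
  linear_combination h

theorem NN.sum {n : ℕ} {f : Fin n → M} (hf : ∀ i, NN (f i)) : NN (∑ i, f i) := by
  induction n with
  | zero => left; simp
  | succ n ih => rw [Fin.sum_univ_succ]; exact (hf 0).add (ih fun i => hf i.succ)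

theorem sgn_sgn_add_one (x : M) :
    (NN x ∧ sgn (sgn x + 1) = 1) ∨ (¬ NN x ∧ sgn (sgn x + 1) = 0) := by
  by_cases hx : x = 0
  · left; subst hx; exact ⟨Or.inl rfl, by rw [sgn_zero, zero_add, sgn_one]⟩
  rcases sgn_cases hx with h | h
  · left
    refine ⟨Or.inr h, ?_⟩
    rw [h]
    have h2 := sgn_add (1 : M) 1
    simp only [sub_self, zero_mul, sub_zero, one_mul, sgn_one] at h2
    linear_combination h2
  · by_cases h2 : sgn x = 1
    · left
      refine ⟨Or.inr h2, ?_⟩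
      have h3 := sgn_add (1 : M) 1
      simp only [sub_self, zero_mul, sub_zero, one_mul, sgn_one] at h3
      rw [h2]; linear_combination h3
    · right
      refine ⟨fun hn => hn.elim hx h2, ?_⟩
      rw [h, neg_add_cancel, sgn_zero]

theorem isProb_iff {p : M} : IsProb p ↔ NN p ∧ NN (1 - p) := by
  by_cases h01 : (0 : M) = 1
  · have hs : ∀ x y : M, x = y := fun x y => by
      rw [← one_mul x, ← one_mul y, ← h01, zero_mul, zero_mul]
    exact ⟨fun _ => ⟨Or.inl (hs _ _), Or.inl (hs _ _)⟩, fun _ => hs _ _⟩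
  · unfold IsProb
    rcases sgn_sgn_add_one p with ⟨h1, h2⟩ | ⟨h1, h2⟩ <;>
    rcases sgn_sgn_add_one (1 - p) with ⟨h3, h4⟩ | ⟨h3, h4⟩ <;>
    simp [h1, h2, h3, h4, h01]

/-- `1 - π`. -/
def Prob.compl (p : Prob M) : Prob M :=
  ⟨1 - p.1, by
    obtain ⟨h1, h2⟩ := isProb_iff.1 p.2
    exact isProb_iff.2 ⟨h2, by simpa using h1⟩⟩

/-- `π · ρ`. -/
def Prob.mul (p q : Prob M) : Prob M :=
  ⟨p.1 * q.1, by
    obtain ⟨h1, h2⟩ := isProb_iff.1 p.2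
    obtain ⟨h3, h4⟩ := isProb_iff.1 q.2
    refine isProb_iff.2 ⟨h1.mul h3, ?_⟩
    have : 1 - p.1 * q.1 = (1 - q.1) + (1 - p.1) * q.1 := by ring
    rw [this]; exact h4.add (h2.mul h3)⟩

theorem one_sub_mul_inv {a b : M} (hba : NN (b - a)) (hb : NN b) : NN (1 - a * b⁻¹) := by
  by_cases h0 : b = 0
  · rw [h0, inv_zero']; right; rw [mul_zero, sub_zero, sgn_one]
  · have : 1 - a * b⁻¹ = (b - a) * b⁻¹ := by rw [sub_mul, mul_inv_self h0]
    rw [this]; exact hba.mul hb.inv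

/-- `((1 - π) · ρ) / (1 - π · ρ)`. -/
def Prob.cond (p q : Prob M) : Prob M :=
  ⟨((1 - p.1) * q.1) * (1 - p.1 * q.1)⁻¹, by
    obtain ⟨h1, h2⟩ := isProb_iff.1 p.2
    obtain ⟨h3, h4⟩ := isProb_iff.1 q.2
    have h5 := (isProb_iff.1 (p.mul q).2).2
    refine isProb_iff.2 ⟨(h2.mul h3).mul h5.inv, one_sub_mul_inv ?_ h5⟩
    have : 1 - p.1 * q.1 - (1 - p.1) * q.1 = 1 - q.1 := by ring
    rw [this]; exact h4⟩

/-- The probability `1`. -/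
def Prob.one : Prob M := ⟨1, isProb_iff.2 ⟨Or.inr sgn_one, Or.inl (sub_self 1)⟩⟩

/-- Nonnegative weights with sum at most one; the condition under which the nested
probabilistic choice below has probabilities as its indices. -/
def IsSubdist {n : ℕ} (f : Fin n → M) : Prop := (∀ i, NN (f i)) ∧ NN (1 - ∑ i, f i)

theorem IsSubdist.of_sum {n : ℕ} (f : Fin n → Prob M) (hf : ∑ i, (f i).1 = 1) :
    IsSubdist fun i => (f i).1 :=
  ⟨fun i => (isProb_iff.1 (f i).2).1, Or.inl (by rw [hf, sub_self])⟩

theorem IsSubdist.head {n : ℕ} {f : Fin (n + 1) → M} (hf : IsSubdist f) : IsProb (f 0) := by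
  refine isProb_iff.2 ⟨hf.1 0, ?_⟩
  have : 1 - f 0 = (1 - ∑ i, f i) + ∑ i : Fin n, f i.succ := by
    rw [Fin.sum_univ_succ]; ring
  rw [this]; exact hf.2.add (NN.sum fun i => hf.1 _)

theorem IsSubdist.tail {n : ℕ} {f : Fin (n + 1) → M} (hf : IsSubdist f) :
    IsSubdist fun i : Fin n => f i.succ * (1 - f 0)⁻¹ := by
  have h := (isProb_iff.1 hf.head).2
  refine ⟨fun i => (hf.1 _).mul h.inv, ?_⟩
  rw [← Finset.sum_mul]
  refine one_sub_mul_inv ?_ h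
  have : 1 - f 0 - ∑ i : Fin n, f i.succ = 1 - ∑ i, f i := by
    rw [Fin.sum_univ_succ]; ring
  rw [this]; exact hf.2

end Meadow

/-! ### Terms -/

/-- Terms over the signature of pACP with actions `A` and probabilities `P`, extended with
additional `n`-ary operators `O n` and additional constants `K`. Variables are natural numbers.
The pACP constants are the elements of `Option A`, where `none` is inaction. -/
inductive PTerm (A : Type u) (P : Type v) (O : ℕ → Type o) (K : Type k) :
    Type (max u v o k) where
  | var (X : ℕ)
  | const (a : Option A)
  | alt (x y : PTerm A P O K)
  | seq (x y : PTerm A P O K)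
  | palt (p : P) (x y : PTerm A P O K)
  | par (x y : PTerm A P O K)
  | lmerge (x y : PTerm A P O K)
  | cmerge (x y : PTerm A P O K)
  | encap (H : Set A) (x : PTerm A P O K)
  | op {n : ℕ} (f : O n) (x : Fin n → PTerm A P O K)
  | extra (c : K)

/-- No additional operators: the signature of pACP itself. -/
abbrev NoOp (_ : ℕ) : Type := Empty

namespace PTerm

variable {A : Type u} {P : Type v} {O : ℕ → Type o} {K : Type k}

/-- The inaction constant. -/
abbrev dead : PTerm A P O K := const none

/-- The constant of an action. -/
abbrev act (a : A) : PTerm A P O K := const (some a)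

/-- The variables that occur in a term. -/
def vars : PTerm A P O K → Set ℕ
  | var X => {X}
  | const _ => ∅
  | alt x y => x.vars ∪ y.vars
  | seq x y => x.vars ∪ y.vars
  | palt _ x y => x.vars ∪ y.vars
  | par x y => x.vars ∪ y.vars
  | lmerge x y => x.vars ∪ y.vars
  | cmerge x y => x.vars ∪ y.vars
  | encap _ x => x.vars
  | op _ x => ⋃ i, (x i).vars
  | extra _ => ∅

def Closed (t : PTerm A P O K) : Prop := t.vars = ∅

/-- Every occurrence of a variable lies in `t'` for some subterm `a · t'` with `a` an action. -/
def Guarded : PTerm A P O K → Prop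
  | var _ => False
  | const _ => True
  | alt x y => x.Guarded ∧ y.Guarded
  | seq x y => (∃ a : A, x = act a) ∨ (x.Guarded ∧ y.Guarded)
  | palt _ x y => x.Guarded ∧ y.Guarded
  | par x y => x.Guarded ∧ y.Guarded
  | lmerge x y => x.Guarded ∧ y.Guarded
  | cmerge x y => x.Guarded ∧ y.Guarded
  | encap _ x => x.Guarded
  | op _ x => ∀ i, (x i).Guarded
  | extra _ => True

/-- Simultaneous substitution in a term without additional constants. -/
def inst (σ : ℕ → PTerm A P O K) : PTerm A P O Empty → PTerm A P O K
  | var X => σ X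
  | const a => const a
  | alt x y => alt (x.inst σ) (y.inst σ)
  | seq x y => seq (x.inst σ) (y.inst σ)
  | palt p x y => palt p (x.inst σ) (y.inst σ)
  | par x y => par (x.inst σ) (y.inst σ)
  | lmerge x y => lmerge (x.inst σ) (y.inst σ)
  | cmerge x y => cmerge (x.inst σ) (y.inst σ)
  | encap H x => encap H (x.inst σ)
  | op f x => op f fun i => (x i).inst σ
  | extra c => c.elim

/-- A pACP term regarded as a term over a larger signature. -/
def ofPACP : PTerm A P NoOp Empty → PTerm A P O Empty
  | var X => var X
  | const a => const a
  | alt x y => alt x.ofPACP y.ofPACP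
  | seq x y => seq x.ofPACP y.ofPACP
  | palt p x y => palt p x.ofPACP y.ofPACP
  | par x y => par x.ofPACP y.ofPACP
  | lmerge x y => lmerge x.ofPACP y.ofPACP
  | cmerge x y => cmerge x.ofPACP y.ofPACP
  | encap H x => encap H x.ofPACP
  | op f _ => f.elim
  | extra c => c.elim

/-- Right-nested probabilistic choice of `t 0, …, t (n-1)` with weights `f 0, …, f (n-1)`.
(Only `n ≥ 1` is used.) -/
def prc {M : Type v} [SignedCancellationMeadow M] :
    (n : ℕ) → (f : Fin n → M) → IsSubdist f → (Fin n → PTerm A (Prob M) O K) →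
      PTerm A (Prob M) O K
  | 0, _, _, _ => dead
  | 1, _, _, t => t 0
  | n + 2, f, hf, t =>
      palt ⟨f 0, hf.head⟩ (t 0)
        (prc (n + 1) (fun i => f i.succ * (1 - f 0)⁻¹) hf.tail fun i => t i.succ)

end PTerm

open PTerm

/-! ### Derivability -/

/-- A set of conditional equations: `Ax Γ l r` says that `l = r` under the premises `p.1 = p.2`,
`p ∈ Γ`, is an axiom. All sets of axioms below consist of all substitution instances of certain
schemes. -/
abbrev Axioms (A : Type u) (P : Type v) (O : ℕ → Type o) (K : Type k) :=
  Set (PTerm A P O K × PTerm A P O K) → PTerm A P O K → PTerm A P O K → Prop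

/-- Derivability in (infinitary) conditional equational logic. -/
inductive Deriv {A : Type u} {P : Type v} {O : ℕ → Type o} {K : Type k} (Ax : Axioms A P O K) :
    PTerm A P O K → PTerm A P O K → Prop
  | ax {Γ l r} : Ax Γ l r → (∀ p ∈ Γ, Deriv Ax p.1 p.2) → Deriv Ax l r
  | refl (x) : Deriv Ax x x
  | symm {x y} : Deriv Ax x y → Deriv Ax y x
  | trans {x y z} : Deriv Ax x y → Deriv Ax y z → Deriv Ax x z
  | alt {x x' y y'} : Deriv Ax x x' → Deriv Ax y y' → Deriv Ax (alt x y) (alt x' y')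
  | seq {x x' y y'} : Deriv Ax x x' → Deriv Ax y y' → Deriv Ax (seq x y) (seq x' y')
  | palt (p) {x x' y y'} :
      Deriv Ax x x' → Deriv Ax y y' → Deriv Ax (palt p x y) (palt p x' y')
  | par {x x' y y'} : Deriv Ax x x' → Deriv Ax y y' → Deriv Ax (par x y) (par x' y')
  | lmerge {x x' y y'} : Deriv Ax x x' → Deriv Ax y y' → Deriv Ax (lmerge x y) (lmerge x' y')
  | cmerge {x x' y y'} : Deriv Ax x x' → Deriv Ax y y' → Deriv Ax (cmerge x y) (cmerge x' y')
  | encap (H) {x x'} : Deriv Ax x x' → Deriv Ax (encap H x) (encap H x')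
  | op {n : ℕ} (f : O n) {x x' : Fin n → PTerm A P O K} :
      (∀ i, Deriv Ax (x i) (x' i)) → Deriv Ax (op f x) (op f x')

/-! ### The axioms of pACP -/

/-- A communication function; `none` is inaction. -/
structure CommFn (A : Type u) where
  γ : Option A → Option A → Option A
  comm : ∀ a b, γ a b = γ b a
  assoc : ∀ a b c, γ (γ a b) c = γ a (γ b c)
  dead : ∀ a, γ none a = none

/-- The axioms of pACP. -/
inductive PACPAx {A : Type u} {M : Type v} [SignedCancellationMeadow M] {O : ℕ → Type o}
    {K : Type k} (c : CommFn A) : Axioms A (Prob M) O K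
  | A1 (x y) : PACPAx c ∅ (alt x y) (alt y x)
  | A2 (x y z) : PACPAx c ∅ (alt (alt x y) z) (alt x (alt y z))
  | A3' (a) : PACPAx c ∅ (alt (const a) (const a)) (const a)
  | A4 (x y z) : PACPAx c ∅ (seq (alt x y) z) (alt (seq x z) (seq y z))
  | A5 (x y z) : PACPAx c ∅ (seq (seq x y) z) (seq x (seq y z))
  | A6 (x) : PACPAx c ∅ (alt x dead) x
  | A7 (x) : PACPAx c ∅ (seq dead x) dead
  | D1 (H : Set A) (a : Option A) (ha : ∀ b ∈ H, a ≠ some b) :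
      PACPAx c ∅ (encap H (const a)) (const a)
  | D2 (H : Set A) (a : A) (ha : a ∈ H) : PACPAx c ∅ (encap H (act a)) dead
  | D3 (H) (x y) : PACPAx c ∅ (encap H (alt x y)) (alt (encap H x) (encap H y))
  | D4 (H) (x y) : PACPAx c ∅ (encap H (seq x y)) (seq (encap H x) (encap H y))
  | pA1 (p : Prob M) (x y) : PACPAx c ∅ (palt p x y) (palt p.compl y x)
  | pA2 (p q : Prob M) (x y z) :
      PACPAx c ∅ (palt q (palt p x y) z) (palt (p.mul q) x (palt (p.cond q) y z))
  | pA3 (p) (x) : PACPAx c ∅ (palt p x x) x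
  | pA4 (p) (x y z) : PACPAx c ∅ (seq (palt p x y) z) (palt p (seq x z) (seq y z))
  | pA5 (p) (x y z) : PACPAx c ∅ (alt (palt p x y) z) (palt p (alt x z) (alt y z))
  | pA6 (x y) : PACPAx c ∅ (palt Prob.one x y) x
  | CM1' (x y) : PACPAx c {(x, alt x x), (y, alt y y)}
      (par x y) (alt (alt (lmerge x y) (lmerge y x)) (cmerge x y))
  | CM2 (a) (x) : PACPAx c ∅ (lmerge (const a) x) (seq (const a) x)
  | CM3 (a) (x y) : PACPAx c ∅ (lmerge (seq (const a) x) y) (seq (const a) (par x y))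
  | CM4 (x y z) : PACPAx c ∅ (lmerge (alt x y) z) (alt (lmerge x z) (lmerge y z))
  | CM5 (a b) (x) : PACPAx c ∅ (cmerge (seq (const a) x) (const b)) (seq (const (c.γ a b)) x)
  | CM6 (a b) (x) : PACPAx c ∅ (cmerge (const a) (seq (const b) x)) (seq (const (c.γ a b)) x)
  | CM7 (a b) (x y) : PACPAx c ∅ (cmerge (seq (const a) x) (seq (const b) y))
      (seq (const (c.γ a b)) (par x y))
  | CM8 (x y z) : PACPAx c ∅ (cmerge (alt x y) z) (alt (cmerge x z) (cmerge y z))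
  | CM9 (x y z) : PACPAx c ∅ (cmerge x (alt y z)) (alt (cmerge x y) (cmerge x z))
  | CM10 (x) : PACPAx c ∅ (cmerge dead x) dead
  | CM11 (x) : PACPAx c ∅ (cmerge x dead) dead
  | CM12 (a b) : PACPAx c ∅ (cmerge (const a) (const b)) (const (c.γ a b))
  | pCM1 (p) (x y z) : PACPAx c ∅ (par (palt p x y) z) (palt p (par x z) (par y z))
  | pCM2 (p) (x y z) : PACPAx c ∅ (par x (palt p y z)) (palt p (par x y) (par x z))
  | pCM3 (p) (x y z) : PACPAx c ∅ (lmerge (palt p x y) z) (palt p (lmerge x z) (lmerge y z))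
  | pCM4 (p) (x y z) : PACPAx c ∅ (lmerge x (palt p y z)) (palt p (lmerge x y) (lmerge x z))
  | pCM5 (p) (x y z) : PACPAx c ∅ (cmerge (palt p x y) z) (palt p (cmerge x z) (cmerge y z))
  | pCM6 (p) (x y z) : PACPAx c ∅ (cmerge x (palt p y z)) (palt p (cmerge x y) (cmerge x z))
  | pD (H) (p) (x y) : PACPAx c ∅ (encap H (palt p x y)) (palt p (encap H x) (encap H y))

/-! ### Strategic interleaving -/

/-- The sequences that are interleaving histories for `n` processes (`n ≥ 1`). A pair `(i, n)`
records that the `i`-th process (counted from `1`) had a turn and that there were `n` processes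
after it. Before the first turn there may have been `n + 1` processes, whence `i ≤ n + 1`. -/
inductive IsHist : ℕ → List (ℕ × ℕ) → Prop
  | nil {n} : 1 ≤ n → IsHist n []
  | single {i n} : 1 ≤ i → 1 ≤ n → i ≤ n + 1 → IsHist n [(i, n)]
  | snoc {h i n j m} : IsHist n (h ++ [(i, n)]) → 1 ≤ j → j ≤ n → 1 ≤ m →
      n ≤ m + 1 → m ≤ n + 1 → IsHist m (h ++ [(i, n)] ++ [(j, m)])

/-- Interleaving histories for `n` processes; there are none if `n = 0`. -/
abbrev Hist (n : ℕ) : Type := {h : List (ℕ × ℕ) // IsHist n h}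

/-- The history `h` followed by a turn of process `i`, after which there are `m` processes. -/
def Hist.push {n : ℕ} (h : Hist n) (i : Fin n) (m : ℕ) (hm : 1 ≤ m) (h1 : n ≤ m + 1)
    (h2 : m ≤ n + 1) : Hist m :=
  ⟨h.1 ++ [(i.1 + 1, m)], by
    have hi := i.2
    obtain ⟨l, hl⟩ := h
    cases hl with
    | nil _ => exact IsHist.single (by omega) hm (by omega)
    | @single j _ a b c =>
      exact IsHist.snoc (h := []) (IsHist.single a b c) (by omega) (by omega) hm h1 h2
    | snoc a b c d e f =>
      exact IsHist.snoc (IsHist.snoc a b c d e f) (by omega) (by omega) hm h1 h2⟩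

theorem Hist.pos {n : ℕ} (h : Hist n) : 1 ≤ n := by
  obtain ⟨l, hl⟩ := h
  cases hl <;> assumption

/-- The strategic interleaving operators and the positional strategic interleaving operators
of arity `n`, with control states `S`. -/
inductive SIOp (S : Type w) (n : ℕ) : Type w
  | si (h : Hist n) (s : S)
  | posm (i : Fin n) (h : Hist n) (s : S)

/-- An interleaving strategy: abstract schedulers (`none` means undefined), control state
transformers (the last argument tells whether the process terminates), control actions `C`,
and the action `bar c` left as a trace of the control action `c`. -/
structure Strategy {A : Type u} (M : Type v) [SignedCancellationMeadow M] (S : Type w)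
    (c : CommFn A) where
  sched : (n : ℕ) → Hist n → S → Option (Fin n → Prob M)
  updat : (n : ℕ) → Hist n → S → Fin n → A → Bool → S
  C : Set A
  bar : C → A
  sched_sum : ∀ n h s f, sched n h s = some f → ∑ i, (f i).1 = 1
  updat_eq : ∀ n h s i a, a ∉ C → updat n h s i a false = s
  bar_notMem : ∀ e, bar e ∉ C
  comm_ne : ∀ (e : C) (a b : A), c.γ (some a) (some b) ≠ some e.1
  comm_ne_bar : ∀ (e : C) (a b : A), c.γ (some a) (some b) ≠ some (bar e)
  comm_dead : ∀ (e : C) (a : A), c.γ (some a) (some e.1) = none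
  comm_bar_dead : ∀ (e : C) (a : A), c.γ (some a) (some (bar e)) = none

/-- The data for creation: `cr d` is the request to start `crea d`, a closed term of pACP with
strategic interleaving (without recursion), and `crBar d` is the act of carrying it out. -/
structure Creation {A : Type u} (M : Type v) [SignedCancellationMeadow M] (S : Type w)
    (D : Type z) (c : CommFn A) where
  cr : D → A
  crBar : D → A
  crea : D → {t : PTerm A (Prob M) (SIOp S) Empty // t.Closed}
  comm_dead : ∀ d (a : A), c.γ (some (cr d)) (some a) = none
  comm_ne : ∀ d (a b : A), c.γ (some a) (some b) ≠ some (cr d)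

section SI

variable {A : Type u} {M : Type v} [SignedCancellationMeadow M] {S : Type w} {D : Type z}
  {c : CommFn A}

/-- The created term `crea d`, read as a term over the signature with constants `K`. -/
def Creation.created (cre : Creation M S D c) (K : Type k) (d : D) :
    PTerm A (Prob M) (SIOp S) K := (cre.crea d).1.inst var

/-- The actions that are neither of the form `cr d` nor of the form `crBar d`. -/
def Creation.Plain (cre : Creation M S D c) (a : A) : Prop :=
  (∀ d, a ≠ cre.cr d) ∧ ∀ d, a ≠ cre.crBar d

/-- The actions of the form `crBar d` that are not also of the form `cr d'`. -/
def Creation.Spent (cre : Creation M S D c) (a : A) : Prop :=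
  (∃ d, a = cre.crBar d) ∧ ∀ d, a ≠ cre.cr d

/-- The axioms for strategic interleaving. `Function.update x i y` is the tuple `x` with `y` in
position `i`, `fun j => x (i.succAbove j)` is `x` without position `i`, and `Fin.snoc x y` is `x`
followed by `y`. -/
inductive SIAx (str : Strategy M S c) (cre : Creation M S D c) {K : Type k} :
    Axioms A (Prob M) (SIOp S) K
  | SI0' {n} (h : Hist n) (s) (x) (hs : str.sched n h s = none) :
      SIAx str cre {p | ∃ i, p = (x i, alt (x i) (x i))} (op (.si h s) x) dead
  | SI1' {n} (h : Hist n) (s) (x) (f) (hf : str.sched n h s = some f) :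
      SIAx str cre {p | ∃ i, p = (x i, alt (x i) (x i))} (op (.si h s) x)
        (prc n (fun i => (f i).1) (.of_sum f (str.sched_sum n h s f hf))
          fun i => op (.posm i h s) x)
  | SI2 {n} (i) (h : Hist n) (s) (x) :
      SIAx str cre ∅ (op (.posm i h s) (Function.update x i dead)) dead
  | SI3 (i) (h : Hist 1) (s) (a) (ha : cre.Plain a) :
      SIAx str cre ∅ (op (.posm i h s) fun _ => act a) (act a)
  | SI4 {n} (hn : 1 ≤ n) (i) (h : Hist (n + 1)) (s) (x) (a) (ha : cre.Plain a) :
      SIAx str cre ∅ (op (.posm i h s) (Function.update x i (act a)))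
        (seq (act a)
          (op (.si (h.push i n hn le_rfl (by omega)) (str.updat (n + 1) h s i a true))
            fun j => x (i.succAbove j)))
  | SI5 {n} (i) (h : Hist n) (s) (x) (y) (a) (ha : cre.Plain a) :
      SIAx str cre ∅ (op (.posm i h s) (Function.update x i (seq (act a) y)))
        (seq (act a)
          (op (.si (h.push i n h.pos (by omega) (by omega)) (str.updat n h s i a false))
            (Function.update x i y)))
  | SI6 {n} (i) (h : Hist (n + 1)) (s) (x) (d) :
      SIAx str cre ∅ (op (.posm i h s) (Function.update x i (act (cre.cr d))))
        (seq (act (cre.crBar d))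
          (op (.si (h.push i (n + 1) h.pos (by omega) (by omega))
              (str.updat (n + 1) h s i (cre.cr d) true))
            (Fin.snoc (α := fun _ => PTerm A (Prob M) (SIOp S) K)
              (fun j => x (i.succAbove j)) (cre.created K d))))
  | SI7 {n} (i) (h : Hist n) (s) (x) (y) (d) :
      SIAx str cre ∅ (op (.posm i h s) (Function.update x i (seq (act (cre.cr d)) y)))
        (seq (act (cre.crBar d))
          (op (.si (h.push i (n + 1) (by omega) (by omega) le_rfl)
              (str.updat n h s i (cre.cr d) false))
            (Fin.snoc (α := fun _ => PTerm A (Prob M) (SIOp S) K)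
              (Function.update x i y) (cre.created K d))))
  | SI8 {n} (i) (h : Hist n) (s) (x) (y z) :
      SIAx str cre ∅ (op (.posm i h s) (Function.update x i (alt y z)))
        (alt (op (.posm i h s) (Function.update x i y))
          (op (.posm i h s) (Function.update x i z)))
  | pSI1 {n} (i) (h : Hist n) (s) (p) (x) (y z) :
      SIAx str cre ∅ (op (.si h s) (Function.update x i (palt p y z)))
        (palt p (op (.si h s) (Function.update x i y))
          (op (.si h s) (Function.update x i z)))
  | pSI2 {n} (i) (h : Hist n) (s) (p) (x) (y z) :
      SIAx str cre ∅ (op (.posm i h s) (Function.update x i (palt p y z)))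
        (palt p (op (.posm i h s) (Function.update x i y))
          (op (.posm i h s) (Function.update x i z)))
  /- The two remaining schemes state equationally that a creation act `crBar d` of the process
  whose turn it is is inactive, as in the operational semantics, which has no rule for it. -/
  | SI2a {n} (i) (h : Hist n) (s) (x) (a) (ha : cre.Spent a) :
      SIAx str cre ∅ (op (.posm i h s) (Function.update x i (act a))) dead
  | SI2b {n} (i) (h : Hist n) (s) (x) (y) (a) (ha : cre.Spent a) :
      SIAx str cre ∅ (op (.posm i h s) (Function.update x i (seq (act a) y))) dead

/-- The axioms of pACP+pSI. -/
def PSIAx (str : Strategy M S c) (cre : Creation M S D c) (K : Type k) :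
    Axioms A (Prob M) (SIOp S) K :=
  fun Γ l r => PACPAx c Γ l r ∨ SIAx str cre Γ l r

end SI

/-! ### Guarded recursion -/

/-- A recursive specification: an equation `X = rhs X` for each `X` in the set `dom` of
variables, where only variables from `dom` occur in the right-hand sides. -/
structure RecSpec (A : Type u) (P : Type v) (O : ℕ → Type o) where
  dom : Set ℕ
  rhs : dom → PTerm A P O Empty
  vars_subset : ∀ X, (rhs X).vars ⊆ dom

section Recursion

variable {A : Type u} {P : Type v} {O : ℕ → Type o}

/-- Rewritability by the axioms in either direction and by the equations of `E` other than the
one for `X` from left to right. -/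
inductive Rewrites (Ax : Axioms A P O Empty) (E : RecSpec A P O) (X : ℕ) :
    PTerm A P O Empty → PTerm A P O Empty → Prop
  | ax {x y} : Deriv Ax x y → Rewrites Ax E X x y
  | unfold (Y : E.dom) : Y.1 ≠ X → Rewrites Ax E X (var Y.1) (E.rhs Y)
  | trans {x y z} : Rewrites Ax E X x y → Rewrites Ax E X y z → Rewrites Ax E X x z
  | alt {x x' y y'} : Rewrites Ax E X x x' → Rewrites Ax E X y y' →
      Rewrites Ax E X (alt x y) (alt x' y')
  | seq {x x' y y'} : Rewrites Ax E X x x' → Rewrites Ax E X y y' →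
      Rewrites Ax E X (seq x y) (seq x' y')
  | palt (p) {x x' y y'} : Rewrites Ax E X x x' → Rewrites Ax E X y y' →
      Rewrites Ax E X (palt p x y) (palt p x' y')
  | par {x x' y y'} : Rewrites Ax E X x x' → Rewrites Ax E X y y' →
      Rewrites Ax E X (par x y) (par x' y')
  | lmerge {x x' y y'} : Rewrites Ax E X x x' → Rewrites Ax E X y y' →
      Rewrites Ax E X (lmerge x y) (lmerge x' y')
  | cmerge {x x' y y'} : Rewrites Ax E X x x' → Rewrites Ax E X y y' →
      Rewrites Ax E X (cmerge x y) (cmerge x' y')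
  | encap (H) {x x'} : Rewrites Ax E X x x' → Rewrites Ax E X (encap H x) (encap H x')
  | op {n : ℕ} (f : O n) {x x' : Fin n → PTerm A P O Empty} :
      (∀ i, Rewrites Ax E X (x i) (x' i)) → Rewrites Ax E X (op f x) (op f x')

/-- Guardedness of a recursive specification over the theory with axioms `Ax`. -/
def RecSpec.IsGuarded (Ax : Axioms A P O Empty) (E : RecSpec A P O) : Prop :=
  ∀ X : E.dom, ∃ t, Rewrites Ax E X.1 (E.rhs X) t ∧ t.Guarded

/-- The constants `⟨X|E⟩`, where `E` is a guarded recursive specification over the theory with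
axioms `Ax` and `X` is a variable of `E`. -/
structure RecConst (Ax : Axioms A P O Empty) where
  E : RecSpec A P O
  guarded : E.IsGuarded Ax
  X : E.dom

open Classical in
/-- The substitution `t ↦ ⟨t|E⟩`: each variable `Y` of `E` is replaced by `⟨Y|E⟩`. -/
noncomputable def RecSpec.sol {Ax : Axioms A P O Empty} (E : RecSpec A P O)
    (hE : E.IsGuarded Ax) (Y : ℕ) : PTerm A P O (RecConst Ax) :=
  if hY : Y ∈ E.dom then extra ⟨E, hE, ⟨Y, hY⟩⟩ else var Y

/-- The axioms RDP and RSP; `σ` is an arbitrary substitution. -/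
inductive RecAx (Ax : Axioms A P O Empty) : Axioms A P O (RecConst Ax)
  | RDP (E) (hE : E.IsGuarded Ax) (X : E.dom) :
      RecAx Ax ∅ (extra ⟨E, hE, X⟩) ((E.rhs X).inst (E.sol hE))
  | RSP (E) (hE : E.IsGuarded Ax) (X : E.dom) (σ : ℕ → PTerm A P O (RecConst Ax)) :
      RecAx Ax {p | ∃ Y : E.dom, p = (σ Y.1, (E.rhs Y).inst σ)} (σ X.1) (extra ⟨E, hE, X⟩)

theorem vars_ofPACP (t : PTerm A P NoOp Empty) : (t.ofPACP : PTerm A P O Empty).vars = t.vars := by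
  induction t with
  | op f => exact f.elim
  | extra c => exact c.elim
  | _ => simp_all [ofPACP, vars]

/-- A recursive specification over pACP regarded as one over a larger signature. -/
def RecSpec.ofPACP (E : RecSpec A P NoOp) : RecSpec A P O where
  dom := E.dom
  rhs X := (E.rhs X).ofPACP
  vars_subset X := by rw [vars_ofPACP]; exact E.vars_subset X

end Recursion

section Theories

variable {A : Type u} {M : Type v} [SignedCancellationMeadow M] {S : Type w} {D : Type z}
  {c : CommFn A}

/-- The terms of pACP+pSI with guarded recursion. -/
abbrev PSIrecTerm (str : Strategy M S c) (cre : Creation M S D c) :=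
  PTerm A (Prob M) (SIOp S) (RecConst (PSIAx str cre Empty))

/-- The axioms of pACP+pSI with guarded recursion. -/
def PSIrecAx (str : Strategy M S c) (cre : Creation M S D c) :
    Axioms A (Prob M) (SIOp S) (RecConst (PSIAx str cre Empty)) :=
  fun Γ l r => PSIAx str cre _ Γ l r ∨ RecAx (PSIAx str cre Empty) Γ l r

/-- The terms of pACP with guarded recursion: no (positional) strategic interleaving operator
occurs, and in each constant `⟨X|E⟩` that occurs, `E` is a guarded recursive specification over
pACP, i.e. its right-hand sides are pACP terms and it is guarded for the axioms of pACP. -/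
def IsPACPrec {str : Strategy M S c} {cre : Creation M S D c} : PSIrecTerm str cre → Prop
  | var _ => True
  | const _ => True
  | alt x y => IsPACPrec x ∧ IsPACPrec y
  | seq x y => IsPACPrec x ∧ IsPACPrec y
  | palt _ x y => IsPACPrec x ∧ IsPACPrec y
  | par x y => IsPACPrec x ∧ IsPACPrec y
  | lmerge x y => IsPACPrec x ∧ IsPACPrec y
  | cmerge x y => IsPACPrec x ∧ IsPACPrec y
  | encap _ x => IsPACPrec x
  | op _ _ => False
  | extra e => ∃ E₀ : RecSpec A (Prob M) NoOp, E₀.IsGuarded (PACPAx c) ∧ e.E = E₀.ofPACP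

end Theories

end PSI

namespace PSI

universe u v w z k o

open PTerm

/-! ### Substitution -/

namespace PTerm

section

variable {A : Type u} {P : Type v} {O : ℕ → Type o} {K : Type k}

/-! The core is a head normal form theorem (`HasHNF.of_closed`): every closed term is derivably
equal to nested probabilistic choices between sums of constants and prefixes `a · u` with `u`
closed. Nothing else is asked of the continuations `u`: they may still contain interleaving
operators and arbitrary recursion constants, so nothing has to be eliminated behind a prefix.

The normal form is found by induction on the term, since each operator has axioms that push it
through choices and sums and let it act on the first actions. A constant `⟨X|E⟩` is unfolded by RDP.
Its right-hand side rewrites to a guarded term, and this rewriting is sound under any substitution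
that solves `E` (`Rewrites.deriv_inst`). In a guarded term, variables occur only behind prefixes, so
the same induction applies (`HasHNF.of_guarded`).

A head normal form has finitely many continuations, so the terms reachable from `t` by repeatedly
taking continuations form a countable set (`exists_countable_hnf`). Countably many variables suffice
to name them. Replacing continuations by their names turns the head normal forms into guarded pACP
right-hand sides. The reachable terms solve the resulting specification, and RSP identifies `t` with
one of its constants. Thus `t'` is a single recursion constant. -/

theorem inst_congr {σ τ : ℕ → PTerm A P O K} (t : PTerm A P O Empty)
    (h : ∀ X ∈ t.vars, σ X = τ X) : t.inst σ = t.inst τ := by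
  induction t with
  | var X => exact h X rfl
  | const a => rfl
  | extra e => exact e.elim
  | op f x ih =>
    simp only [inst]
    congr 1
    funext i
    exact ih i fun X hX => h X (Set.mem_iUnion.2 ⟨i, hX⟩)
  | encap H x ih =>
    simp only [inst]
    rw [ih h]
  | _ =>
    rename_i ih₁ ih₂
    simp only [inst]
    rw [ih₁ fun X hX => h X (Or.inl hX), ih₂ fun X hX => h X (Or.inr hX)]

theorem inst_var (t : PTerm A P O Empty) : t.inst var = t := by
  induction t with
  | extra e => exact e.elim
  | _ => simp_all [inst]

theorem vars_inst (σ : ℕ → PTerm A P O K) (t : PTerm A P O Empty) :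
    (t.inst σ).vars = ⋃ X ∈ t.vars, (σ X).vars := by
  induction t with
  | extra e => exact e.elim
  | op f x ih =>
    ext Y
    simp only [inst, vars, ih, Set.mem_iUnion]
    exact ⟨fun ⟨i, X, hX, h⟩ => ⟨X, ⟨i, hX⟩, h⟩, fun ⟨X, ⟨i, hX⟩, h⟩ => ⟨i, X, hX, h⟩⟩
  | encap H x ih => exact ih
  | var X => simp [inst, vars]
  | const a => simp [inst, vars]
  | _ =>
    rename_i ih₁ ih₂
    simp only [inst, vars]
    rw [ih₁, ih₂, Set.biUnion_union]

theorem closed_inst {σ : ℕ → PTerm A P O K} (hσ : ∀ X, (σ X).Closed) (t : PTerm A P O Empty) :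
    (t.inst σ).Closed := by
  unfold Closed at *
  rw [vars_inst]
  simp [hσ]

theorem inst_update {n : ℕ} (σ : ℕ → PTerm A P O K) (x : Fin n → PTerm A P O Empty) (i : Fin n)
    (y : PTerm A P O Empty) :
    (fun j => (Function.update x i y j).inst σ)
      = Function.update (fun j => (x j).inst σ) i (y.inst σ) := by
  funext j
  by_cases h : j = i
  · subst h; simp
  · simp [h]

theorem inst_snoc {n : ℕ} (σ : ℕ → PTerm A P O K) (x : Fin n → PTerm A P O Empty)
    (y : PTerm A P O Empty) :
    (fun j => (Fin.snoc (α := fun _ => PTerm A P O Empty) x y j).inst σ)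
      = Fin.snoc (α := fun _ => PTerm A P O K) (fun j => (x j).inst σ) (y.inst σ) := by
  funext j
  refine Fin.lastCases ?_ (fun j => ?_) j <;> simp

theorem closed_alt {x y : PTerm A P O K} : (alt x y).Closed ↔ x.Closed ∧ y.Closed :=
  Set.union_empty_iff

theorem closed_seq {x y : PTerm A P O K} : (seq x y).Closed ↔ x.Closed ∧ y.Closed :=
  Set.union_empty_iff

theorem closed_palt {p : P} {x y : PTerm A P O K} : (palt p x y).Closed ↔ x.Closed ∧ y.Closed :=
  Set.union_empty_iff

theorem closed_par {x y : PTerm A P O K} : (par x y).Closed ↔ x.Closed ∧ y.Closed :=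
  Set.union_empty_iff

theorem closed_lmerge {x y : PTerm A P O K} : (lmerge x y).Closed ↔ x.Closed ∧ y.Closed :=
  Set.union_empty_iff

theorem closed_cmerge {x y : PTerm A P O K} : (cmerge x y).Closed ↔ x.Closed ∧ y.Closed :=
  Set.union_empty_iff

theorem closed_encap {H : Set A} {x : PTerm A P O K} : (encap H x).Closed ↔ x.Closed := Iff.rfl

theorem closed_op {n : ℕ} {f : O n} {x : Fin n → PTerm A P O K} :
    (op f x).Closed ↔ ∀ i, (x i).Closed :=
  Set.iUnion_eq_empty

theorem closed_const (a : Option A) : (const a : PTerm A P O K).Closed := rfl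

theorem closed_update {n : ℕ} {x : Fin n → PTerm A P O K} (hx : ∀ j, (x j).Closed) (i : Fin n)
    {y : PTerm A P O K} (hy : y.Closed) (j : Fin n) : (Function.update x i y j).Closed := by
  by_cases h : j = i
  · subst h; simpa using hy
  · simpa [h] using hx j

theorem closed_snoc {n : ℕ} {x : Fin n → PTerm A P O K} (hx : ∀ j, (x j).Closed)
    {y : PTerm A P O K} (hy : y.Closed) (j : Fin (n + 1)) :
    (Fin.snoc (α := fun _ => PTerm A P O K) x y j).Closed := by
  refine Fin.lastCases ?_ (fun j => ?_) j
  · simpa using hy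
  · simpa using hx j

end

theorem inst_prc {A : Type u} {M : Type v} [SignedCancellationMeadow M] {O : ℕ → Type o}
    {K : Type k} (σ : ℕ → PTerm A (Prob M) O K) : (n : ℕ) → (f : Fin n → M) →
      (hf : IsSubdist f) → (t : Fin n → PTerm A (Prob M) O Empty) →
      (prc n f hf t).inst σ = prc n f hf fun i => (t i).inst σ
  | 0, _, _, _ => rfl
  | 1, _, _, _ => rfl
  | n + 2, f, hf, t => by
    simp only [prc, inst]
    rw [inst_prc σ (n + 1)]

end PTerm

/-! ### Stability of derivations and rewriting under substitution -/

section Soundness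

variable {A : Type u} {M : Type v} [SignedCancellationMeadow M] {S : Type w} {D : Type z}
  {c : CommFn A}

/-- Every scheme is closed under substitution. The premises are assumed derivable after substitution
because CM1' is conditional. -/
theorem PACPAx.deriv_inst {O : ℕ → Type o} {K : Type k} {Ax : Axioms A (Prob M) O K}
    (hAx : ∀ Γ l r, PACPAx c Γ l r → Ax Γ l r) (σ : ℕ → PTerm A (Prob M) O K)
    {Γ : Set (PTerm A (Prob M) O Empty × PTerm A (Prob M) O Empty)}
    {l r : PTerm A (Prob M) O Empty} (h : PACPAx c Γ l r)
    (hΓ : ∀ p ∈ Γ, Deriv Ax (p.1.inst σ) (p.2.inst σ)) : Deriv Ax (l.inst σ) (r.inst σ) := by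
  cases h
  case CM1' x y =>
    refine .ax (hAx _ _ _ (.CM1' (x.inst σ) (y.inst σ))) ?_
    rintro p (rfl | rfl)
    · exact hΓ (x, alt x x) (Or.inl rfl)
    · exact hΓ (y, alt y y) (Or.inr rfl)
  case D1 H a ha => exact .ax (hAx _ _ _ (.D1 H a ha)) fun _ h => h.elim
  case D2 H a ha => exact .ax (hAx _ _ _ (.D2 H a ha)) fun _ h => h.elim
  all_goals
    refine .ax (Γ := ∅) (hAx _ _ _ ?_) fun _ h => h.elim
    constructor

/-- The created term is closed, so no substitution affects it. This makes the instances of SI6 and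
SI7 stable under substitution. -/
theorem Creation.created_inst (cre : Creation M S D c) {K : Type k}
    (σ : ℕ → PTerm A (Prob M) (SIOp S) K) (d : D) :
    (cre.created Empty d).inst σ = cre.created K d := by
  unfold Creation.created
  rw [inst_var]
  exact inst_congr _ fun X hX => by rw [(cre.crea d).2] at hX; exact hX.elim

theorem Creation.closed_created (cre : Creation M S D c) (K : Type k) (d : D) :
    (cre.created K d).Closed := by
  rw [← cre.created_inst (fun _ => dead)]
  exact closed_inst (fun _ => closed_const _) _

theorem SIAx.deriv_inst {str : Strategy M S c} {cre : Creation M S D c} {K : Type k}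
    {Ax : Axioms A (Prob M) (SIOp S) K}
    (hAx : ∀ Γ l r, SIAx str cre Γ l r → Ax Γ l r) (σ : ℕ → PTerm A (Prob M) (SIOp S) K)
    {Γ : Set (PTerm A (Prob M) (SIOp S) Empty × PTerm A (Prob M) (SIOp S) Empty)}
    {l r : PTerm A (Prob M) (SIOp S) Empty} (h : SIAx str cre Γ l r)
    (hΓ : ∀ p ∈ Γ, Deriv Ax (p.1.inst σ) (p.2.inst σ)) : Deriv Ax (l.inst σ) (r.inst σ) := by
  cases h
  case SI0' n h s x hs =>
    refine .ax (hAx _ _ _ (.SI0' h s _ hs)) ?_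
    rintro _ ⟨i, rfl⟩
    exact hΓ _ ⟨i, rfl⟩
  case SI1' n h s x f hf =>
    rw [inst_prc]
    refine .ax (hAx _ _ _ (.SI1' h s _ f hf)) ?_
    rintro _ ⟨i, rfl⟩
    exact hΓ _ ⟨i, rfl⟩
  all_goals
    simp only [inst, inst_update, inst_snoc, Creation.created_inst]
    refine .ax (Γ := ∅) (hAx _ _ _ ?_) fun _ h => h.elim
  case SI2 => exact .SI2 ..
  case SI3 ha => exact .SI3 _ _ _ _ ha
  case SI4 hn _ _ _ _ _ ha => exact .SI4 hn _ _ _ (fun j => inst σ _) _ ha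
  case SI5 ha => exact .SI5 _ _ _ _ _ _ ha
  case SI6 => exact .SI6 _ _ _ (fun j => inst σ _) _
  case SI7 => exact .SI7 ..
  case SI8 => exact .SI8 ..
  case pSI1 => exact .pSI1 ..
  case pSI2 => exact .pSI2 ..
  case SI2a ha => exact .SI2a _ _ _ _ _ ha
  case SI2b ha => exact .SI2b _ _ _ _ _ _ ha

theorem Deriv.inst {str : Strategy M S c} {cre : Creation M S D c} {K : Type k}
    {Ax : Axioms A (Prob M) (SIOp S) K} (hAx : ∀ Γ l r, PSIAx str cre K Γ l r → Ax Γ l r)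
    (σ : ℕ → PTerm A (Prob M) (SIOp S) K) {x y : PTerm A (Prob M) (SIOp S) Empty}
    (h : Deriv (PSIAx str cre Empty) x y) : Deriv Ax (x.inst σ) (y.inst σ) := by
  induction h with
  | ax h _ ih =>
    rcases h with h | h
    · exact h.deriv_inst (fun _ _ _ h => hAx _ _ _ (Or.inl h)) σ ih
    · exact h.deriv_inst (fun _ _ _ h => hAx _ _ _ (Or.inr h)) σ ih
  | refl => exact .refl _
  | symm _ ih => exact .symm ih
  | trans _ _ ih₁ ih₂ => exact .trans ih₁ ih₂
  | alt _ _ ih₁ ih₂ => exact .alt ih₁ ih₂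
  | seq _ _ ih₁ ih₂ => exact .seq ih₁ ih₂
  | palt p _ _ ih₁ ih₂ => exact .palt p ih₁ ih₂
  | par _ _ ih₁ ih₂ => exact .par ih₁ ih₂
  | lmerge _ _ ih₁ ih₂ => exact .lmerge ih₁ ih₂
  | cmerge _ _ ih₁ ih₂ => exact .cmerge ih₁ ih₂
  | encap H _ ih => exact .encap H ih
  | op f _ ih => exact .op f ih

/-- Rewriting is sound for every substitution that solves the specification. -/
theorem Rewrites.deriv_inst {str : Strategy M S c} {cre : Creation M S D c} {K : Type k}
    {Ax : Axioms A (Prob M) (SIOp S) K} (hAx : ∀ Γ l r, PSIAx str cre K Γ l r → Ax Γ l r)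
    {σ : ℕ → PTerm A (Prob M) (SIOp S) K} {E : RecSpec A (Prob M) (SIOp S)}
    (hσ : ∀ Y : E.dom, Deriv Ax (σ Y.1) ((E.rhs Y).inst σ)) {X : ℕ}
    {x y : PTerm A (Prob M) (SIOp S) Empty}
    (h : Rewrites (PSIAx str cre Empty) E X x y) : Deriv Ax (x.inst σ) (y.inst σ) := by
  induction h with
  | ax h => exact h.inst hAx σ
  | unfold Y _ => exact hσ Y
  | trans _ _ ih₁ ih₂ => exact .trans ih₁ ih₂
  | alt _ _ ih₁ ih₂ => exact .alt ih₁ ih₂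
  | seq _ _ ih₁ ih₂ => exact .seq ih₁ ih₂
  | palt p _ _ ih₁ ih₂ => exact .palt p ih₁ ih₂
  | par _ _ ih₁ ih₂ => exact .par ih₁ ih₂
  | lmerge _ _ ih₁ ih₂ => exact .lmerge ih₁ ih₂
  | cmerge _ _ ih₁ ih₂ => exact .cmerge ih₁ ih₂
  | encap H _ ih => exact .encap H ih
  | op f _ ih => exact .op f ih

end Soundness

/-! ### Head normal forms -/

section HeadNormalForm

variable {A : Type u} {P : Type v} {O : ℕ → Type o} {K : Type k}

/-- Sums of constants and of terms `a · t` with `a` an action and `Q t`. -/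
inductive IsSum (Q : PTerm A P O K → Prop) : PTerm A P O K → Prop
  | const (a) : IsSum Q (const a)
  | pre (a : A) {t} : Q t → IsSum Q (seq (act a) t)
  | alt {x y} : IsSum Q x → IsSum Q y → IsSum Q (alt x y)

/-- Head normal forms: nested probabilistic choices between sums. -/
inductive IsHNF (Q : PTerm A P O K → Prop) : PTerm A P O K → Prop
  | sum {x} : IsSum Q x → IsHNF Q x
  | palt (p) {x y} : IsHNF Q x → IsHNF Q y → IsHNF Q (palt p x y)

/-- Derivable equality to a head normal form in which all terms after a prefix are closed. -/
def HasHNF (Ax : Axioms A P O K) (x : PTerm A P O K) : Prop :=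
  ∃ y, Deriv Ax x y ∧ IsHNF Closed y

theorem IsSum.closed {x : PTerm A P O K} (h : IsSum Closed x) : x.Closed := by
  induction h with
  | const a => rfl
  | pre a h => exact closed_seq.2 ⟨rfl, h⟩
  | alt _ _ ih₁ ih₂ => exact closed_alt.2 ⟨ih₁, ih₂⟩

theorem IsSum.mono {Q R : PTerm A P O K → Prop} (hQR : ∀ t, Q t → R t) {x : PTerm A P O K}
    (h : IsSum Q x) : IsSum R x := by
  induction h with
  | const a => exact .const a
  | pre a h => exact .pre a (hQR _ h)
  | alt _ _ ih₁ ih₂ => exact .alt ih₁ ih₂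

theorem IsHNF.mono {Q R : PTerm A P O K → Prop} (hQR : ∀ t, Q t → R t) {x : PTerm A P O K}
    (h : IsHNF Q x) : IsHNF R x := by
  induction h with
  | sum h => exact .sum (h.mono hQR)
  | palt p _ _ ih₁ ih₂ => exact .palt p ih₁ ih₂

/-- Isolates the finitely many continuations; this finiteness is what later keeps the set of
reachable terms countable. -/
theorem IsSum.exists_finite {Q : PTerm A P O K → Prop} {x : PTerm A P O K} (h : IsSum Q x) :
    ∃ F : Set (PTerm A P O K), F.Finite ∧ (∀ t ∈ F, Q t) ∧ IsSum (· ∈ F) x := by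
  induction h with
  | const a => exact ⟨∅, Set.finite_empty, fun _ h => h.elim, .const a⟩
  | @pre a t h =>
    exact ⟨{t}, Set.finite_singleton t, fun _ h' => by rw [h']; exact h, .pre a rfl⟩
  | alt _ _ ih₁ ih₂ =>
    obtain ⟨F, hF, hQ, h⟩ := ih₁
    obtain ⟨G, hG, hR, h'⟩ := ih₂
    exact ⟨F ∪ G, hF.union hG, fun t ht => ht.elim (hQ t) (hR t),
      .alt (h.mono fun _ => Or.inl) (h'.mono fun _ => Or.inr)⟩

theorem IsHNF.exists_finite {Q : PTerm A P O K → Prop} {x : PTerm A P O K} (h : IsHNF Q x) :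
    ∃ F : Set (PTerm A P O K), F.Finite ∧ (∀ t ∈ F, Q t) ∧ IsHNF (· ∈ F) x := by
  induction h with
  | sum h =>
    obtain ⟨F, hF, hQ, h⟩ := h.exists_finite
    exact ⟨F, hF, hQ, .sum h⟩
  | palt p _ _ ih₁ ih₂ =>
    obtain ⟨F, hF, hQ, h⟩ := ih₁
    obtain ⟨G, hG, hR, h'⟩ := ih₂
    exact ⟨F ∪ G, hF.union hG, fun t ht => ht.elim (hQ t) (hR t),
      .palt p (h.mono fun _ => Or.inl) (h'.mono fun _ => Or.inr)⟩

/-- A sum over the values of `σ` is an instance of a guarded pACP term. -/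
theorem IsSum.exists_inst {σ : ℕ → PTerm A P O K} {x : PTerm A P O K}
    (h : IsSum (· ∈ Set.range σ) x) :
    ∃ t : PTerm A P NoOp Empty, t.Guarded ∧ (t.ofPACP : PTerm A P O Empty).Guarded ∧
      t.ofPACP.inst σ = x := by
  induction h with
  | const a => exact ⟨.const a, trivial, trivial, rfl⟩
  | pre a h =>
    obtain ⟨X, rfl⟩ := h
    exact ⟨.seq (act a) (.var X), Or.inl ⟨a, rfl⟩, Or.inl ⟨a, rfl⟩, rfl⟩
  | alt _ _ ih₁ ih₂ =>
    obtain ⟨t, h, h', rfl⟩ := ih₁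
    obtain ⟨u, h₂, h₂', rfl⟩ := ih₂
    exact ⟨.alt t u, ⟨h, h₂⟩, ⟨h', h₂'⟩, rfl⟩

/-- A head normal form over the values of `σ` is an instance of a guarded pACP term. -/
theorem IsHNF.exists_inst {σ : ℕ → PTerm A P O K} {x : PTerm A P O K}
    (h : IsHNF (· ∈ Set.range σ) x) :
    ∃ t : PTerm A P NoOp Empty, t.Guarded ∧ (t.ofPACP : PTerm A P O Empty).Guarded ∧
      t.ofPACP.inst σ = x := by
  induction h with
  | sum h => exact h.exists_inst
  | palt p _ _ ih₁ ih₂ =>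
    obtain ⟨t, h, h', rfl⟩ := ih₁
    obtain ⟨u, h₂, h₂', rfl⟩ := ih₂
    exact ⟨.palt p t u, ⟨h, h₂⟩, ⟨h', h₂'⟩, rfl⟩

variable {Ax : Axioms A P O K}

theorem Deriv.hasHNF {x y : PTerm A P O K} (h : Deriv Ax x y) (hy : HasHNF Ax y) :
    HasHNF Ax x := by
  obtain ⟨z, hz, hz'⟩ := hy
  exact ⟨z, h.trans hz, hz'⟩

theorem IsHNF.hasHNF {x : PTerm A P O K} (h : IsHNF Closed x) : HasHNF Ax x := ⟨x, .refl x, h⟩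

theorem HasHNF.const (a : Option A) : HasHNF Ax (const a) := (IsHNF.sum (.const a)).hasHNF

theorem HasHNF.pre (a : A) {t : PTerm A P O K} (ht : t.Closed) : HasHNF Ax (seq (act a) t) :=
  (IsHNF.sum (.pre a ht)).hasHNF

theorem HasHNF.palt (p : P) {x y : PTerm A P O K} (hx : HasHNF Ax x) (hy : HasHNF Ax y) :
    HasHNF Ax (palt p x y) := by
  obtain ⟨x', hx, hx'⟩ := hx
  obtain ⟨y', hy, hy'⟩ := hy
  exact ⟨_, .palt p hx hy, .palt p hx' hy'⟩

end HeadNormalForm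

/-! ### Head normal forms under the pACP operators -/

section PACP

variable {A : Type u} {M : Type v} [SignedCancellationMeadow M] {O : ℕ → Type o} {K : Type k}
  {c : CommFn A} {Ax : Axioms A (Prob M) O K}

theorem PACPAx.deriv (hAx : ∀ Γ l r, PACPAx c Γ l r → Ax Γ l r) {l r : PTerm A (Prob M) O K}
    (h : PACPAx c ∅ l r) : Deriv Ax l r :=
  .ax (hAx _ _ _ h) fun _ h => h.elim

/-- Idempotence of `+` is an axiom for constants only. It passes to prefixes by `a · t = (a + a) · t
= a · t + a · t`, and to sums by rearrangement. It supplies the premises of CM1', SI0' and SI1',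
which is why probabilistic choices must be moved outside before those axioms are applied. -/
theorem IsSum.deriv_alt_self (hAx : ∀ Γ l r, PACPAx c Γ l r → Ax Γ l r)
    {Q : PTerm A (Prob M) O K → Prop} {x : PTerm A (Prob M) O K} (h : IsSum Q x) :
    Deriv Ax x (PTerm.alt x x) := by
  induction h with
  | const a => exact .symm ((PACPAx.A3' a).deriv hAx)
  | @pre a t _ =>
    exact .trans (.seq (.symm ((PACPAx.A3' _).deriv hAx)) (.refl t)) ((PACPAx.A4 ..).deriv hAx)
  | @alt x y _ _ ih₁ ih₂ =>
    have h₁ : Deriv Ax (.alt (.alt x x) (.alt y y)) (.alt x (.alt x (.alt y y))) :=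
      (PACPAx.A2 ..).deriv hAx
    -- The exchange that regroups `x + (x + (y + y))` as `(x + y) + (x + y)`.
    have h₂ : Deriv Ax (.alt x (.alt y y)) (.alt y (.alt x y)) :=
      .trans (.symm ((PACPAx.A2 ..).deriv hAx))
        (.trans (.alt ((PACPAx.A1 ..).deriv hAx) (.refl y)) ((PACPAx.A2 ..).deriv hAx))
    exact (ih₁.alt ih₂).trans (h₁.trans
      (.trans (.alt (.refl x) h₂) (.symm ((PACPAx.A2 ..).deriv hAx))))

theorem HasHNF.alt (hAx : ∀ Γ l r, PACPAx c Γ l r → Ax Γ l r) {x y : PTerm A (Prob M) O K}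
    (hx : HasHNF Ax x) (hy : HasHNF Ax y) : HasHNF Ax (alt x y) := by
  obtain ⟨x', hx, hx'⟩ := hx
  obtain ⟨y', hy, hy'⟩ := hy
  refine (hx.alt hy).hasHNF ?_
  clear hx hy
  induction hx' with
  | palt p _ _ ih₁ ih₂ => exact ((PACPAx.pA5 ..).deriv hAx).hasHNF (ih₁.palt p ih₂)
  | sum hx' =>
    induction hy' with
    | sum hy' => exact (IsHNF.sum (hx'.alt hy')).hasHNF
    | palt p _ _ ih₁ ih₂ =>
      have hcomm {u v : PTerm A (Prob M) O K} (h : HasHNF Ax (.alt u v)) :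
          HasHNF Ax (.alt v u) := ((PACPAx.A1 ..).deriv hAx).hasHNF h
      exact hcomm (((PACPAx.pA5 ..).deriv hAx).hasHNF ((hcomm ih₁).palt p (hcomm ih₂)))

/-- Covers prefixes whose head results from communication or encapsulation: that head may be
inaction, which absorbs the continuation by A7. -/
theorem HasHNF.const_seq (hAx : ∀ Γ l r, PACPAx c Γ l r → Ax Γ l r) (a : Option A)
    {t : PTerm A (Prob M) O K} (ht : t.Closed) : HasHNF Ax (seq (.const a) t) := by
  cases a with
  | none => exact ((PACPAx.A7 t).deriv hAx).hasHNF (.const none)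
  | some a => exact .pre a ht

theorem HasHNF.seq (hAx : ∀ Γ l r, PACPAx c Γ l r → Ax Γ l r) {x y : PTerm A (Prob M) O K}
    (hx : HasHNF Ax x) (hy : y.Closed) : HasHNF Ax (seq x y) := by
  obtain ⟨x', hx, hx'⟩ := hx
  refine (hx.seq (.refl y)).hasHNF ?_
  clear hx
  induction hx' with
  | palt p _ _ ih₁ ih₂ => exact ((PACPAx.pA4 ..).deriv hAx).hasHNF (ih₁.palt p ih₂)
  | sum hx' =>
    induction hx' with
    | const a => exact .const_seq hAx a hy
    | pre a ht => exact ((PACPAx.A5 ..).deriv hAx).hasHNF (.pre a (closed_seq.2 ⟨ht, hy⟩))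
    | alt _ _ ih₁ ih₂ => exact ((PACPAx.A4 ..).deriv hAx).hasHNF (ih₁.alt hAx ih₂)

theorem HasHNF.encap (hAx : ∀ Γ l r, PACPAx c Γ l r → Ax Γ l r) (H : Set A)
    {x : PTerm A (Prob M) O K} (hx : HasHNF Ax x) : HasHNF Ax (encap H x) := by
  have hconst (a : Option A) :
      ∃ b : Option A, Deriv Ax (.encap H (.const a) : PTerm A (Prob M) O K) (.const b) := by
    by_cases h : ∃ b ∈ H, a = some b
    · obtain ⟨b, hb, rfl⟩ := h
      exact ⟨none, (PACPAx.D2 H b hb).deriv hAx⟩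
    · exact ⟨a, (PACPAx.D1 H a fun b hb hab => h ⟨b, hb, hab⟩).deriv hAx⟩
  obtain ⟨x', hx, hx'⟩ := hx
  refine (hx.encap H).hasHNF ?_
  clear hx
  induction hx' with
  | palt p _ _ ih₁ ih₂ => exact ((PACPAx.pD ..).deriv hAx).hasHNF (ih₁.palt p ih₂)
  | sum hx' =>
    induction hx' with
    | const a =>
      obtain ⟨b, hb⟩ := hconst a
      exact hb.hasHNF (.const b)
    | pre a ht =>
      obtain ⟨b, hb⟩ := hconst (some a)
      exact (((PACPAx.D4 ..).deriv hAx).trans (.seq hb (.refl _))).hasHNF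
        (.const_seq hAx b (closed_encap.2 ht))
    | alt _ _ ih₁ ih₂ => exact ((PACPAx.D3 ..).deriv hAx).hasHNF (ih₁.alt hAx ih₂)

/-- The left argument makes the first step and `y` ends up behind its prefix, so closedness of `y`
is enough. -/
theorem HasHNF.lmerge (hAx : ∀ Γ l r, PACPAx c Γ l r → Ax Γ l r) {x y : PTerm A (Prob M) O K}
    (hx : HasHNF Ax x) (hy : y.Closed) : HasHNF Ax (lmerge x y) := by
  obtain ⟨x', hx, hx'⟩ := hx
  refine (hx.lmerge (.refl y)).hasHNF ?_
  clear hx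
  induction hx' with
  | palt p _ _ ih₁ ih₂ => exact ((PACPAx.pCM3 ..).deriv hAx).hasHNF (ih₁.palt p ih₂)
  | sum hx' =>
    induction hx' with
    | const a => exact ((PACPAx.CM2 ..).deriv hAx).hasHNF (.const_seq hAx a hy)
    | pre a ht => exact ((PACPAx.CM3 ..).deriv hAx).hasHNF (.pre a (closed_par.2 ⟨ht, hy⟩))
    | alt _ _ ih₁ ih₂ => exact ((PACPAx.CM4 ..).deriv hAx).hasHNF (ih₁.alt hAx ih₂)

theorem HasHNF.cmerge (hAx : ∀ Γ l r, PACPAx c Γ l r → Ax Γ l r) {x y : PTerm A (Prob M) O K}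
    (hx : HasHNF Ax x) (hy : HasHNF Ax y) : HasHNF Ax (cmerge x y) := by
  -- With the left argument fixed, distributivity on the right reduces everything to a constant or a
  -- prefix there. This serves both the constant and the prefix case on the left.
  have hright {u y' : PTerm A (Prob M) O K} (hy' : IsHNF Closed y')
      (hc : ∀ b, HasHNF Ax (.cmerge u (.const b)))
      (hp : ∀ (b : A) (t), t.Closed → HasHNF Ax (.cmerge u (.seq (act b) t))) :
      HasHNF Ax (.cmerge u y') := by
    induction hy' with
    | palt p _ _ ih₁ ih₂ => exact ((PACPAx.pCM6 ..).deriv hAx).hasHNF (ih₁.palt p ih₂)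
    | sum hy' =>
      induction hy' with
      | const b => exact hc b
      | pre b ht => exact hp b _ ht
      | alt _ _ ih₁ ih₂ => exact ((PACPAx.CM9 ..).deriv hAx).hasHNF (ih₁.alt hAx ih₂)
  obtain ⟨x', hx, hx'⟩ := hx
  obtain ⟨y', hy, hy'⟩ := hy
  refine (hx.cmerge hy).hasHNF ?_
  clear hx hy
  induction hx' with
  | palt p _ _ ih₁ ih₂ => exact ((PACPAx.pCM5 ..).deriv hAx).hasHNF (ih₁.palt p ih₂)
  | sum hx' =>
    induction hx' with
    | alt _ _ ih₁ ih₂ => exact ((PACPAx.CM8 ..).deriv hAx).hasHNF (ih₁.alt hAx ih₂)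
    | const a =>
      exact hright hy' (fun b => ((PACPAx.CM12 ..).deriv hAx).hasHNF (.const _))
        fun b t ht => ((PACPAx.CM6 ..).deriv hAx).hasHNF (.const_seq hAx _ ht)
    | pre a ht =>
      exact hright hy' (fun b => ((PACPAx.CM5 ..).deriv hAx).hasHNF (.const_seq hAx _ ht))
        fun b t ht' => ((PACPAx.CM7 ..).deriv hAx).hasHNF
          (.const_seq hAx _ (closed_par.2 ⟨ht, ht'⟩))

/-- The expansion CM1' is available only for idempotent arguments. Choices are therefore pulled out
of both sides first, and CM1' is applied to two sums. -/
theorem HasHNF.par (hAx : ∀ Γ l r, PACPAx c Γ l r → Ax Γ l r) {x y : PTerm A (Prob M) O K}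
    (hx : HasHNF Ax x) (hy : HasHNF Ax y) : HasHNF Ax (par x y) := by
  obtain ⟨x', hx, hx'⟩ := hx
  obtain ⟨y', hy, hy'⟩ := hy
  refine (hx.par hy).hasHNF ?_
  clear hx hy
  induction hx' with
  | palt p _ _ ih₁ ih₂ => exact ((PACPAx.pCM1 ..).deriv hAx).hasHNF (ih₁.palt p ih₂)
  | @sum x hx' =>
    induction hy' with
    | palt p _ _ ih₁ ih₂ => exact ((PACPAx.pCM2 ..).deriv hAx).hasHNF (ih₁.palt p ih₂)
    | @sum y hy' =>
      have h : Deriv Ax (.par x y) (.alt (.alt (.lmerge x y) (.lmerge y x)) (.cmerge x y)) := by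
        refine .ax (hAx _ _ _ (.CM1' x y)) ?_
        rintro p (rfl | rfl)
        · exact hx'.deriv_alt_self hAx
        · exact hy'.deriv_alt_self hAx
      have h₁ : HasHNF Ax x := (IsHNF.sum hx').hasHNF
      have h₂ : HasHNF Ax y := (IsHNF.sum hy').hasHNF
      exact h.hasHNF (((h₁.lmerge hAx hy'.closed).alt hAx (h₂.lmerge hAx hx'.closed)).alt hAx
        (h₁.cmerge hAx h₂))

theorem HasHNF.prc : (n : ℕ) → (f : Fin n → M) → (hf : IsSubdist f) →
    (t : Fin n → PTerm A (Prob M) O K) → (∀ i, HasHNF Ax (t i)) → HasHNF Ax (prc n f hf t)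
  | 0, _, _, _, _ => .const none
  | 1, _, _, _, ht => ht 0
  | n + 2, _, _, _, ht => (ht 0).palt _ (HasHNF.prc (n + 1) _ _ _ fun i => ht i.succ)

end PACP

/-! ### Head normal forms under strategic interleaving, and of guarded terms -/

section Interleaving

variable {A : Type u} {M : Type v} [SignedCancellationMeadow M] {S : Type w} {D : Type z}
  {c : CommFn A} {str : Strategy M S c} {cre : Creation M S D c} {K : Type k}
  {Ax : Axioms A (Prob M) (SIOp S) K}

theorem SIAx.deriv (hAx : ∀ Γ l r, PSIAx str cre K Γ l r → Ax Γ l r)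
    {l r : PTerm A (Prob M) (SIOp S) K} (h : SIAx str cre ∅ l r) : Deriv Ax l r :=
  .ax (hAx _ _ _ (Or.inr h)) fun _ h => h.elim

/-- These are the cases distinguished by the positional axioms. An action of both forms `cr d` and
`crBar d'` counts as a request. -/
theorem Creation.action_cases (cre : Creation M S D c) (a : A) :
    cre.Plain a ∨ (∃ d, a = cre.cr d) ∨ cre.Spent a := by
  by_cases h₁ : ∃ d, a = cre.cr d
  · exact Or.inr (Or.inl h₁)
  by_cases h₂ : ∃ d, a = cre.crBar d
  · exact Or.inr (Or.inr ⟨h₂, fun d h => h₁ ⟨d, h⟩⟩)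
  · exact Or.inl ⟨fun d h => h₁ ⟨d, h⟩, fun d h => h₂ ⟨d, h⟩⟩

theorem HasHNF.posm_act (hAx : ∀ Γ l r, PSIAx str cre K Γ l r → Ax Γ l r) {n : ℕ} (i : Fin n)
    (h : Hist n) (s : S) {x : Fin n → PTerm A (Prob M) (SIOp S) K} (hx : ∀ j, (x j).Closed)
    (a : A) : HasHNF Ax (op (.posm i h s) (Function.update x i (act a))) := by
  -- Histories exist only for at least one process, and SI4 and SI6 are stated for a successor
  -- arity.
  obtain ⟨n, rfl⟩ : ∃ m, n = m + 1 := ⟨n - 1, by have := h.pos; omega⟩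
  rcases cre.action_cases a with ha | ⟨d, rfl⟩ | ha
  · rcases n with _ | n
    · have : Function.update x i (act a) = fun _ => act a := by
        funext j
        rw [Fin.ext (by omega : j.1 = i.1), Function.update_self]
      rw [this]
      exact ((SIAx.SI3 i h s a ha).deriv hAx).hasHNF (.const _)
    · exact ((SIAx.SI4 (by omega) i h s x a ha).deriv hAx).hasHNF
        (.pre a (closed_op.2 fun j => hx _))
  · exact ((SIAx.SI6 i h s x d).deriv hAx).hasHNF (.pre _ (closed_op.2
      (closed_snoc (fun j => hx _) (cre.closed_created K d))))
  · exact ((SIAx.SI2a i h s x a ha).deriv hAx).hasHNF (.const none)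

theorem HasHNF.posm_pre (hAx : ∀ Γ l r, PSIAx str cre K Γ l r → Ax Γ l r) {n : ℕ} (i : Fin n)
    (h : Hist n) (s : S) {x : Fin n → PTerm A (Prob M) (SIOp S) K} (hx : ∀ j, (x j).Closed)
    (a : A) {t : PTerm A (Prob M) (SIOp S) K} (ht : t.Closed) :
    HasHNF Ax (op (.posm i h s) (Function.update x i (.seq (act a) t))) := by
  rcases cre.action_cases a with ha | ⟨d, rfl⟩ | ha
  · exact ((SIAx.SI5 i h s x t a ha).deriv hAx).hasHNF
      (.pre a (closed_op.2 (closed_update hx i ht)))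
  · exact ((SIAx.SI7 i h s x t d).deriv hAx).hasHNF (.pre _ (closed_op.2
      (closed_snoc (closed_update hx i ht) (cre.closed_created K d))))
  · exact ((SIAx.SI2b i h s x t a ha).deriv hAx).hasHNF (.const none)

/-- Only the process whose turn it is takes a step; the other processes land behind the resulting
prefix or disappear, so they need only be closed. -/
theorem HasHNF.posm (hAx : ∀ Γ l r, PSIAx str cre K Γ l r → Ax Γ l r) {n : ℕ} (i : Fin n)
    (h : Hist n) (s : S) {x : Fin n → PTerm A (Prob M) (SIOp S) K} (hx : ∀ j, (x j).Closed)
    (hi : HasHNF Ax (x i)) : HasHNF Ax (op (.posm i h s) x) := by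
  obtain ⟨y, hy, hy'⟩ := hi
  have hxy : Deriv Ax (op (.posm i h s) x) (op (.posm i h s) (Function.update x i y)) := by
    refine .op _ fun j => ?_
    by_cases hj : j = i
    · subst hj; simpa using hy
    · simpa [hj] using Deriv.refl _
  refine hxy.hasHNF ?_
  clear hxy hy
  induction hy' with
  | palt p _ _ ih₁ ih₂ => exact ((SIAx.pSI2 ..).deriv hAx).hasHNF (ih₁.palt p ih₂)
  | sum hy' =>
    induction hy' with
    | alt _ _ ih₁ ih₂ =>
      exact ((SIAx.SI8 ..).deriv hAx).hasHNF
        (ih₁.alt (fun _ _ _ h => hAx _ _ _ (Or.inl h)) ih₂)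
    | pre a ht => exact .posm_pre hAx i h s hx a ht
    | const a =>
      cases a with
      | none => exact ((SIAx.SI2 ..).deriv hAx).hasHNF (.const none)
      | some a => exact .posm_act hAx i h s hx a

theorem HasHNF.si_of_isSum (hAx : ∀ Γ l r, PSIAx str cre K Γ l r → Ax Γ l r) {n : ℕ}
    (h : Hist n) (s : S) {x : Fin n → PTerm A (Prob M) (SIOp S) K}
    (hx : ∀ j, IsSum Closed (x j)) : HasHNF Ax (op (.si h s) x) := by
  have hpre : ∀ p : PTerm A (Prob M) (SIOp S) K × PTerm A (Prob M) (SIOp S) K,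
      p ∈ {p | ∃ i, p = (x i, PTerm.alt (x i) (x i))} → Deriv Ax p.1 p.2 := by
    rintro _ ⟨i, rfl⟩
    exact (hx i).deriv_alt_self fun _ _ _ h => hAx _ _ _ (Or.inl h)
  cases hs : str.sched n h s with
  | none => exact (Deriv.ax (hAx _ _ _ (Or.inr (.SI0' h s x hs))) hpre).hasHNF (.const none)
  | some f =>
    exact (Deriv.ax (hAx _ _ _ (Or.inr (.SI1' h s x f hs))) hpre).hasHNF
      (.prc _ _ _ _ fun i => .posm hAx i h s (fun j => (hx j).closed) (IsHNF.sum (hx i)).hasHNF)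

theorem HasHNF.si (hAx : ∀ Γ l r, PSIAx str cre K Γ l r → Ax Γ l r) {n : ℕ} (h : Hist n) (s : S)
    {x : Fin n → PTerm A (Prob M) (SIOp S) K} (hx : ∀ j, HasHNF Ax (x j)) :
    HasHNF Ax (op (.si h s) x) := by
  -- `F` contains the positions where a probabilistic choice may remain. pSI1 clears them one at a
  -- time, until all entries are sums and the conditional axioms apply.
  have key (F : Finset (Fin n)) : ∀ y : Fin n → PTerm A (Prob M) (SIOp S) K,
      (∀ j, IsHNF Closed (y j)) → (∀ j ∉ F, IsSum Closed (y j)) →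
      HasHNF Ax (op (.si h s) y) := by
    induction F using Finset.induction_on with
    | empty => exact fun y _ hy => .si_of_isSum hAx h s fun j => hy j (by simp)
    | insert i F _ ih =>
      intro y hy hyF
      -- The entry at `i` is generalized to allow induction on its head normal form; updating with
      -- `y i` itself gives back `y`.
      suffices hu : ∀ u, IsHNF Closed u → HasHNF Ax (op (.si h s) (Function.update y i u)) by
        simpa using hu (y i) (hy i)
      intro u hu
      induction hu with
      | palt p _ _ ih₁ ih₂ => exact ((SIAx.pSI1 ..).deriv hAx).hasHNF (ih₁.palt p ih₂)
      | sum hu =>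
        refine ih _ (fun j => ?_) fun j hj => ?_
        · by_cases hji : j = i
          · subst hji; simpa using IsHNF.sum hu
          · simpa [hji] using hy j
        · by_cases hji : j = i
          · subst hji; simpa using hu
          · simpa [hji] using hyF j (by simp [hji, hj])
  choose y hxy hy using hx
  exact (Deriv.op _ hxy).hasHNF (key Finset.univ y hy fun j hj => absurd (Finset.mem_univ j) hj)

theorem HasHNF.op (hAx : ∀ Γ l r, PSIAx str cre K Γ l r → Ax Γ l r) {n : ℕ} (f : SIOp S n)
    {x : Fin n → PTerm A (Prob M) (SIOp S) K} (hx : ∀ j, (x j).Closed)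
    (hx' : ∀ j, HasHNF Ax (x j)) : HasHNF Ax (op f x) := by
  cases f with
  | si h s => exact .si hAx h s hx'
  | posm i h s => exact .posm hAx i h s hx (hx' i)

/-- Closedness of the values of `σ` is enough: a bare variable is not guarded, and whatever follows
an action becomes a continuation without being inspected. -/
theorem HasHNF.of_guarded (hAx : ∀ Γ l r, PSIAx str cre K Γ l r → Ax Γ l r)
    {σ : ℕ → PTerm A (Prob M) (SIOp S) K} (hσ : ∀ X, (σ X).Closed)
    (t : PTerm A (Prob M) (SIOp S) Empty) (ht : t.Guarded) : HasHNF Ax (t.inst σ) := by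
  have hP : ∀ Γ l r, PACPAx c Γ l r → Ax Γ l r := fun _ _ _ h => hAx _ _ _ (Or.inl h)
  induction t with
  | var X => exact ht.elim
  | const a => exact .const a
  | extra e => exact e.elim
  | alt x y ih₁ ih₂ => exact (ih₁ ht.1).alt hP (ih₂ ht.2)
  | seq x y ih₁ ih₂ =>
    rcases ht with ⟨a, rfl⟩ | ht
    · exact .pre a (closed_inst hσ y)
    · exact (ih₁ ht.1).seq hP (closed_inst hσ y)
  | palt p x y ih₁ ih₂ => exact (ih₁ ht.1).palt p (ih₂ ht.2)
  | par x y ih₁ ih₂ => exact (ih₁ ht.1).par hP (ih₂ ht.2)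
  | lmerge x y ih₁ ih₂ => exact (ih₁ ht.1).lmerge hP (closed_inst hσ y)
  | cmerge x y ih₁ ih₂ => exact (ih₁ ht.1).cmerge hP (ih₂ ht.2)
  | encap H x ih => exact (ih ht).encap hP H
  | op f x ih => exact .op hAx f (fun j => closed_inst hσ _) fun j => ih j (ht j)

end Interleaving

/-! ### Head normal forms of recursion constants and of closed terms -/

section Recursion

variable {A : Type u} {M : Type v} [SignedCancellationMeadow M] {S : Type w} {D : Type z}
  {c : CommFn A} {str : Strategy M S c} {cre : Creation M S D c}

theorem PSIAx.toRec (Γ) (l r : PSIrecTerm str cre) (h : PSIAx str cre _ Γ l r) :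
    PSIrecAx str cre Γ l r := Or.inl h

/-- RDP makes the constants of `E` a solution of `E`, so the rewriting of the right-hand side to a
guarded term can be carried out on them. -/
theorem HasHNF.extra (e : RecConst (PSIAx str cre Empty)) :
    HasHNF (PSIrecAx str cre) (extra e) := by
  classical
  obtain ⟨E, hE, X⟩ := e
  -- Unlike `E.sol`, this sends variables outside `E` to inaction, so all its values are closed.
  -- Rewriting may introduce such variables, whereas the right-hand sides of `E` contain none, so
  -- both substitutions agree on them.
  set σ : ℕ → PSIrecTerm str cre := fun Y =>
    if hY : Y ∈ E.dom then .extra ⟨E, hE, ⟨Y, hY⟩⟩ else dead with hσ_def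
  have hσ_dom (Y : E.dom) : σ Y.1 = .extra ⟨E, hE, Y⟩ := dif_pos Y.2
  have hclosed (Y : ℕ) : (σ Y).Closed := by
    simp only [hσ_def]
    split <;> rfl
  have hσ (Y : E.dom) : Deriv (PSIrecAx str cre) (σ Y.1) ((E.rhs Y).inst σ) := by
    have h : (E.rhs Y).inst σ = (E.rhs Y).inst (E.sol hE) := by
      refine inst_congr _ fun Z hZ => ?_
      have hZ' := E.vars_subset Y hZ
      rw [hσ_dom ⟨Z, hZ'⟩, RecSpec.sol, dif_pos hZ']
    rw [hσ_dom, h]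
    exact .ax (Or.inr (.RDP E hE Y)) fun _ h => h.elim
  obtain ⟨t, ht, ht'⟩ := hE X
  have h := (hσ X).trans (ht.deriv_inst PSIAx.toRec hσ)
  rw [hσ_dom] at h
  exact h.hasHNF (.of_guarded PSIAx.toRec hclosed t ht')

/-- Every closed term of pACP+pSI with guarded recursion has a head normal form. -/
theorem HasHNF.of_closed (t : PSIrecTerm str cre) (ht : t.Closed) :
    HasHNF (PSIrecAx str cre) t := by
  have hP : ∀ Γ (l r : PSIrecTerm str cre), PACPAx c Γ l r → PSIrecAx str cre Γ l r :=
    fun _ _ _ h => Or.inl (Or.inl h)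
  induction t with
  | var X => exact absurd ht (Set.singleton_ne_empty X)
  | const a => exact .const a
  | extra e => exact .extra e
  | alt x y ih₁ ih₂ =>
    obtain ⟨hx, hy⟩ := closed_alt.1 ht
    exact (ih₁ hx).alt hP (ih₂ hy)
  | seq x y ih₁ _ =>
    obtain ⟨hx, hy⟩ := closed_seq.1 ht
    exact (ih₁ hx).seq hP hy
  | palt p x y ih₁ ih₂ =>
    obtain ⟨hx, hy⟩ := closed_palt.1 ht
    exact (ih₁ hx).palt p (ih₂ hy)
  | par x y ih₁ ih₂ =>
    obtain ⟨hx, hy⟩ := closed_par.1 ht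
    exact (ih₁ hx).par hP (ih₂ hy)
  | lmerge x y ih₁ _ =>
    obtain ⟨hx, hy⟩ := closed_lmerge.1 ht
    exact (ih₁ hx).lmerge hP hy
  | cmerge x y ih₁ ih₂ =>
    obtain ⟨hx, hy⟩ := closed_cmerge.1 ht
    exact (ih₁ hx).cmerge hP (ih₂ hy)
  | encap H x ih => exact (ih (closed_encap.1 ht)).encap hP H
  | op f x ih =>
    have hx := closed_op.1 ht
    exact .op PSIAx.toRec f hx fun j => ih j (hx j)

end Recursion

/-- If every closed term has a head normal form, then each closed term belongs to a countable
set of terms each of which has a head normal form over that set. -/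
theorem exists_countable_hnf {A : Type u} {P : Type v} {O : ℕ → Type o} {K : Type k}
    {Ax : Axioms A P O K} (hAx : ∀ t : PTerm A P O K, t.Closed → HasHNF Ax t)
    {t : PTerm A P O K} (ht : t.Closed) :
    ∃ R : Set (PTerm A P O K), R.Countable ∧ t ∈ R ∧
      ∀ x ∈ R, ∃ y, Deriv Ax x y ∧ IsHNF (· ∈ R) y := by
  -- Stated on the subtype of closed terms so that the choice of continuations can be iterated.
  have hstep : ∀ x : {x : PTerm A P O K // x.Closed}, ∃ F : Set {x : PTerm A P O K // x.Closed},
      F.Countable ∧ ∃ y, Deriv Ax x.1 y ∧ IsHNF (· ∈ Subtype.val '' F) y := by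
    rintro ⟨x, hx⟩
    obtain ⟨y, hxy, hy⟩ := hAx x hx
    obtain ⟨F, hF, hFc, hyF⟩ := hy.exists_finite
    refine ⟨Subtype.val ⁻¹' F, ?_, y, hxy, hyF.mono fun u hu => ⟨⟨u, hFc u hu⟩, hu, rfl⟩⟩
    exact hF.countable.preimage Subtype.val_injective
  choose F hF y hxy hy using hstep
  -- `G n` contains the terms reached from `t` by taking continuations `n` times.
  let G : ℕ → Set {x : PTerm A P O K // x.Closed} :=
    fun n => Nat.rec {⟨t, ht⟩} (fun _ s => ⋃ x ∈ s, F x) n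
  have hG (n : ℕ) : (G n).Countable := by
    induction n with
    | zero => exact Set.countable_singleton _
    | succ n ih => exact ih.biUnion fun x _ => hF x
  refine ⟨Subtype.val '' ⋃ n, G n, (Set.countable_iUnion hG).image _,
    ⟨⟨t, ht⟩, Set.mem_iUnion.2 ⟨0, rfl⟩, rfl⟩, ?_⟩
  rintro _ ⟨x, hx, rfl⟩
  obtain ⟨n, hn⟩ := Set.mem_iUnion.1 hx
  refine ⟨y x, hxy x, (hy x).mono fun u hu => Set.image_mono (fun v hv => ?_) hu⟩
  exact Set.mem_iUnion.2 ⟨n + 1, Set.mem_biUnion hn hv⟩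

end PSI

/-! ### A guarded specification over pACP solved by the reachable terms -/

open PSI PSI.PTerm in
theorem mainTheorem7 {A : Type*} {M : Type*} [PSI.SignedCancellationMeadow M] {S : Type*}
    {D : Type*} (c : PSI.CommFn A) (str : PSI.Strategy M S c) (cre : PSI.Creation M S D c)
    (t : PSI.PSIrecTerm str cre) (ht : t.Closed) :
    ∃ t' : PSI.PSIrecTerm str cre, t'.Closed ∧ PSI.IsPACPrec t' ∧
      PSI.Deriv (PSI.PSIrecAx str cre) t t' := by
  obtain ⟨R, hR, htR, hnf⟩ := exists_countable_hnf HasHNF.of_closed ht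
  -- The variable `X` names the term `σ X`. A term may have several names, which is harmless.
  obtain ⟨σ, rfl⟩ := hR.exists_eq_range ⟨t, htR⟩
  have hrhs (X : ℕ) : ∃ r : PTerm A (Prob M) NoOp Empty, r.Guarded ∧
      (r.ofPACP : PTerm A (Prob M) (SIOp S) Empty).Guarded ∧
      Deriv (PSIrecAx str cre) (σ X) (r.ofPACP.inst σ) := by
    obtain ⟨y, hxy, hy⟩ := hnf (σ X) ⟨X, rfl⟩
    obtain ⟨r, hr, hr', rfl⟩ := hy.exists_inst
    exact ⟨r, hr, hr', hxy⟩
  choose r hr hr' hσ using hrhs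
  obtain ⟨X, rfl⟩ := htR
  let E : RecSpec A (Prob M) NoOp := ⟨Set.univ, fun X => r X.1, fun _ => Set.subset_univ _⟩
  -- The right-hand sides are already guarded, so no rewriting is needed. Guardedness is needed
  -- twice: over pACP for `t'` to be a pACP term, and over pACP+pSI for its constant to exist in the
  -- ambient theory.
  have hE : E.IsGuarded (PACPAx c) := fun X => ⟨r X.1, .ax (.refl _), hr X.1⟩
  have hE' : (E.ofPACP : RecSpec A (Prob M) (SIOp S)).IsGuarded (PSIAx str cre Empty) :=
    fun X => ⟨(r X.1).ofPACP, .ax (.refl _), hr' X.1⟩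
  refine ⟨.extra ⟨E.ofPACP, hE', ⟨X, Set.mem_univ X⟩⟩, rfl, ⟨E, hE, rfl⟩, ?_⟩
  -- The premises of RSP say that `σ` solves the specification, which is `hσ`.
  refine .ax (Or.inr (.RSP E.ofPACP hE' ⟨X, Set.mem_univ X⟩ σ)) ?_
  rintro _ ⟨Y, rfl⟩
  exact hσ Y.1
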